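/- The (infinite) grid is the graph on $\mathbb{Z}^2$ in which two points are joined by an edge if they are at distance one on a common row or a common column. A bend of a path in the grid is an inner point of the path at which it turns from horizontal to vertical or conversely. A $B_2$-EPG representation of a graph $G$ assigns to every vertex $v$ a path $P_v$ of the grid with at most two bends, such that two distinct vertices $u,v$ are adjacent in $G$ if and only if $P_u$ and $P_v$ have at least one grid edge in common. A $B_2$-EPG graph is a finite graph with such a representation. Theorem. There is a polynomial-time algorithm that, given a $B_2$-EPG graph $G$ with a $B_2$-EPG representation, computes a maximum clique of $G$ (that is, a clique with the largest possible number of vertices). Here the representation is given by the number $n$ of vertices and, for every vertex $v$, the coordinates of the end points and of the bends of $P_v$, in their order along the path. The running time is measured on a random access machine with integer registers and arrays, whose unit-cost operations are assignments of constants, copying, addition, subtraction, comparison, and reading or writing an array cell at a computed index; it is bounded by a polynomial in $n$ (independently of the size of the coordinates). The output is the indicator function of the clique on the set of vertices. -/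

import Mathlib

/-! ### Edge-intersection graphs of paths on a grid -/

/-- The orthogonal grid: the points are the pairs (column, row) of integers, and two points are
joined by a grid edge if they are at distance one on a common column or on a common row. -/
def gridGraph : SimpleGraph (ℤ × ℤ) where
  Adj p q := (p.1 = q.1 ∧ |p.2 - q.2| = 1) ∨ (p.2 = q.2 ∧ |p.1 - q.1| = 1)
  symm := ⟨fun p q h => by
    rcases h with ⟨h, h'⟩ | ⟨h, h'⟩
    · exact Or.inl ⟨h.symm, by rw [abs_sub_comm]; exact h'⟩
    · exact Or.inr ⟨h.symm, by rw [abs_sub_comm]; exact h'⟩⟩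
  loopless := ⟨fun p h => by simp at h⟩

/-- The bends, in order, of a path given by the list of the grid points that it visits: the inner
points `q` at which the path turns, that is, at which the previous point, `q` and the next point
are neither on a common column nor on a common row. -/
def bendPoints : List (ℤ × ℤ) → List (ℤ × ℤ)
  | p :: q :: r :: l =>
      if (p.1 = q.1 ∧ q.1 = r.1) ∨ (p.2 = q.2 ∧ q.2 = r.2) then bendPoints (q :: r :: l)
      else q :: bendPoints (q :: r :: l)
  | _ => []

/-- A representation of `G` as a `B_k`-EPG graph: every vertex is assigned a (simple) path of the
grid with at most `k` bends, and two distinct vertices are adjacent if and only if their paths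
have a grid edge in common. -/
structure EPGRep (k : ℕ) {V : Type*} (G : SimpleGraph V) where
  source : V → ℤ × ℤ
  target : V → ℤ × ℤ
  path : ∀ v, gridGraph.Path (source v) (target v)
  bends_le : ∀ v, (bendPoints (path v).1.support).length ≤ k
  adj_iff : ∀ u v, G.Adj u v ↔ u ≠ v ∧ ∃ e, e ∈ (path u).1.edges ∧ e ∈ (path v).1.edges

/-- The corners of the path of `v`: its source, its bends in order, and then its target
(for all further indices). -/
def EPGRep.corner {k : ℕ} {V : Type*} {G : SimpleGraph V} (R : EPGRep k G) (v : V) (j : ℕ) :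
    ℤ × ℤ :=
  (R.source v :: bendPoints (R.path v).1.support).getD j (R.target v)

/-! ### Random access machines

A random access machine with integer registers and integer arrays. A program is a fixed finite
text, so it uses only finitely many registers and arrays. Every instruction and every test costs
one step. The arithmetic is restricted to addition and subtraction, so that one step lengthens
the numbers in the memory by at most one bit. -/
namespace RAM

/-- A configuration of the memory: the contents of the registers, and the contents of the cells
of the arrays. -/
@[ext] structure State where
  reg : ℕ → ℤ
  arr : ℕ → ℤ → ℤ

/-- The instructions. -/
inductive Instr where
  /-- `x := c` -/
  | const (x : ℕ) (c : ℤ)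
  /-- `x := y` -/
  | copy (x y : ℕ)
  /-- `x := y + z` -/
  | add (x y z : ℕ)
  /-- `x := y - z` -/
  | sub (x y z : ℕ)
  /-- `x := a[i]`, where `i` is a register -/
  | load (x a i : ℕ)
  /-- `a[i] := x`, where `i` is a register -/
  | store (a i x : ℕ)

/-- The effect of an instruction on the memory. -/
def Instr.apply : Instr → State → State
  | const x c, s => { s with reg := Function.update s.reg x c }
  | copy x y, s => { s with reg := Function.update s.reg x (s.reg y) }
  | add x y z, s => { s with reg := Function.update s.reg x (s.reg y + s.reg z) }
  | sub x y z, s => { s with reg := Function.update s.reg x (s.reg y - s.reg z) }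
  | load x a i, s => { s with reg := Function.update s.reg x (s.arr a (s.reg i)) }
  | store a i x, s =>
      { s with arr := Function.update s.arr a (Function.update (s.arr a) (s.reg i) (s.reg x)) }

/-- The programs. The tests compare two registers. -/
inductive Prog where
  | instr (c : Instr)
  | seq (P Q : Prog)
  /-- if `x < y` then `P` else `Q` -/
  | branch (x y : ℕ) (P Q : Prog)
  /-- while `x < y` do `P` -/
  | loop (x y : ℕ) (P : Prog)

/-- `Exec P s t s'`: started in the memory `s`, the program `P` halts after exactly `t` steps, in
the memory `s'`. -/
inductive Exec : Prog → State → ℕ → State → Prop where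
  | instr (c : Instr) (s : State) : Exec (.instr c) s 1 (c.apply s)
  | seq {P Q : Prog} {s s' s'' : State} {t t' : ℕ} :
      Exec P s t s' → Exec Q s' t' s'' → Exec (.seq P Q) s (t + t') s''
  | branch_true {x y : ℕ} {P Q : Prog} {s s' : State} {t : ℕ} :
      s.reg x < s.reg y → Exec P s t s' → Exec (.branch x y P Q) s (t + 1) s'
  | branch_false {x y : ℕ} {P Q : Prog} {s s' : State} {t : ℕ} :
      ¬ s.reg x < s.reg y → Exec Q s t s' → Exec (.branch x y P Q) s (t + 1) s'
  | loop_true {x y : ℕ} {P : Prog} {s s' s'' : State} {t t' : ℕ} :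
      s.reg x < s.reg y → Exec P s t s' → Exec (.loop x y P) s' t' s'' →
        Exec (.loop x y P) s (t + t' + 1) s''
  | loop_false {x y : ℕ} {P : Prog} {s : State} :
      ¬ s.reg x < s.reg y → Exec (.loop x y P) s 1 s

/-- The machine is deterministic: the number of steps and the final memory are determined by the
program and the initial memory. -/
theorem Exec.deterministic {P : Prog} {s s₁ s₂ : State} {t₁ t₂ : ℕ}
    (h₁ : Exec P s t₁ s₁) (h₂ : Exec P s t₂ s₂) : t₁ = t₂ ∧ s₁ = s₂ := by
  induction h₁ generalizing t₂ s₂ with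
  | instr c s => cases h₂; exact ⟨rfl, rfl⟩
  | seq _ _ ih ih' =>
    cases h₂ with
    | seq k k' =>
      obtain ⟨rfl, rfl⟩ := ih k
      obtain ⟨rfl, rfl⟩ := ih' k'
      exact ⟨rfl, rfl⟩
  | branch_true h _ ih =>
    cases h₂ with
    | branch_true _ k => obtain ⟨rfl, rfl⟩ := ih k; exact ⟨rfl, rfl⟩
    | branch_false g _ => exact absurd h g
  | branch_false h _ ih =>
    cases h₂ with
    | branch_true g _ => exact absurd g h
    | branch_false _ k => obtain ⟨rfl, rfl⟩ := ih k; exact ⟨rfl, rfl⟩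
  | loop_true h _ _ ih ih' =>
    cases h₂ with
    | loop_true _ k k' =>
      obtain ⟨rfl, rfl⟩ := ih k
      obtain ⟨rfl, rfl⟩ := ih' k'
      exact ⟨rfl, rfl⟩
    | loop_false g => exact absurd h g
  | loop_false h =>
    cases h₂ with
    | loop_true g _ _ => exact absurd g h
    | loop_false _ => exact ⟨rfl, rfl⟩

end RAM

/-- The input for a `B_2`-EPG graph on the vertices `0, …, n - 1` with its representation:
register 0 holds `n`, and, for `j ≤ 3`, cell `i` of array `2 * j` (of array `2 * j + 1`) holds the
column (the row) of the `j`-th of the four corners of the path of vertex `i`.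
Everything else is 0. -/
def EPGRep.input {n : ℕ} {G : SimpleGraph (Fin n)} (R : EPGRep 2 G) : RAM.State where
  reg x := if x = 0 then (n : ℤ) else 0
  arr a i :=
    if h : a < 8 ∧ 0 ≤ i ∧ i < (n : ℤ) then
      if a % 2 = 0 then (R.corner ⟨i.toNat, by omega⟩ (a / 2)).1
      else (R.corner ⟨i.toNat, by omega⟩ (a / 2)).2
    else 0

/-!
A clique of a `B_2`-EPG graph is covered by two cliques of a special form. The order type of a path
over a family of vertices records how its corners compare with the corners of the family. If the
family contains members of the clique with extremal coordinates among those of each order type, then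
two paths whose order types occur in the clique share an edge, unless they run along two common
parallel lines `a < b` of the family. For such lines, let the pivot be the first point of `a` by
which two members of the clique that run along both lines, but do not overlap near `b`, have both
ended on `a`. Of the members that run along both lines, those that contain the edge before the pivot
overlap on `a`, and the others overlap near `b`; hence the clique splits into two parts, whose order
types define cliques once the family contains the pivots. The number of vertices in the family is
bounded by a constant `m`.

Hence it is enough to run through all `m`-tuples of vertices and all pairs of sets of order types
over the tuple that define cliques. For two disjoint cliques the complement of the graph that they
span is bipartite, and its largest independent sets are read off an auction: unmatched vertices of
one side bid for their cheapest neighbours on the other side and raise the price by one. At the end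
there is a level that is not a price, and the bidders that own nothing of a lower price, together
with the items of a lower price, are independent; every vertex outside this set is matched to one
inside it, so no independent set is larger.
-/

/-! ### Rectilinear paths with three segments -/

/-- The four corners of a path: `p j false` is the column and `p j true` the row of corner `j`.
So a segment along `o` lies on a line that is given by its coordinate `!o`. -/
abbrev Corners := Fin 4 → Bool → ℤ

namespace Corners

variable {p q : Corners} {o : Bool} {a b l r L R : ℤ}

/-- Up to degenerate segments, the path consists of a segment along `o`, one across, and one
along. If the middle segment is degenerate, then so is the last one. -/
def Shape (o : Bool) (p : Corners) : Prop :=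
  p 0 (!o) = p 1 (!o) ∧ p 1 o = p 2 o ∧ p 2 (!o) = p 3 (!o) ∧ (p 1 (!o) = p 2 (!o) → p 2 o = p 3 o)

/-- The corners of a path with at most two bends. -/
def Valid (p : Corners) : Prop := ∃ o, Shape o p

/-- `i` and `j` are consecutive corners, joined by a nondegenerate segment along `o`; the corner
with the smaller coordinate comes first. -/
def Seg (p : Corners) (o : Bool) (i j : Fin 4) : Prop :=
  (i.val + 1 = j.val ∨ j.val + 1 = i.val) ∧ p i (!o) = p j (!o) ∧ p i o < p j o

/-- The interval from `l` to `r` on the line along `o` at `a` is a segment of the path. -/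
def HasSeg (p : Corners) (o : Bool) (a l r : ℤ) : Prop :=
  ∃ i j, Seg p o i j ∧ p i (!o) = a ∧ p i o = l ∧ p j o = r

/-- The path has a segment on the line along `o` at `a`. -/
def Uses (p : Corners) (o : Bool) (a : ℤ) : Prop := ∃ l r, HasSeg p o a l r

/-- The paths have an edge in common on the line along `o` at `a`. -/
def Overlap (p q : Corners) (o : Bool) (a : ℤ) : Prop :=
  ∃ l r L R, HasSeg p o a l r ∧ HasSeg q o a L R ∧ l < R ∧ L < r

/-- The paths have an edge in common. -/
def Share (p q : Corners) : Prop := ∃ o a, Overlap p q o a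

/-- The paths have an edge in common on the line along `o` at `a` or on some line across. -/
def OverlapNear (p q : Corners) (o : Bool) (a : ℤ) : Prop :=
  Overlap p q o a ∨ ∃ b, Overlap p q (!o) b

theorem Overlap.symm (h : Overlap p q o a) : Overlap q p o a := by
  obtain ⟨l, r, L, R, hp, hq, h, h'⟩ := h
  exact ⟨L, R, l, r, hq, hp, h', h⟩

theorem Share.symm (h : Share p q) : Share q p := by
  obtain ⟨o, a, h⟩ := h
  exact ⟨o, a, h.symm⟩

theorem OverlapNear.symm (h : OverlapNear p q o a) : OverlapNear q p o a :=
  h.imp Overlap.symm fun ⟨b, h⟩ => ⟨b, h.symm⟩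

theorem Overlap.uses_left (h : Overlap p q o a) : Uses p o a := by
  obtain ⟨l, r, L, R, hp, -⟩ := h
  exact ⟨l, r, hp⟩

theorem Overlap.uses_right (h : Overlap p q o a) : Uses q o a := h.symm.uses_left

theorem Seg.hasSeg {i j : Fin 4} (h : Seg p o i j) : HasSeg p o (p i (!o)) (p i o) (p j o) :=
  ⟨i, j, h, rfl, rfl, rfl⟩

theorem HasSeg.lt (h : HasSeg p o a l r) : l < r := by
  obtain ⟨i, j, h, -, rfl, rfl⟩ := h
  exact h.2.2

theorem Share.self_left (h : Share p q) : Share p p := by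
  obtain ⟨o, a, l, r, _, _, hp, -⟩ := h
  exact ⟨o, a, l, r, l, r, hp, hp, hp.lt, hp.lt⟩

theorem Valid.shape_or (h : Valid p) (o : Bool) : Shape o p ∨ Shape (!o) p := by
  obtain ⟨o', h⟩ := h
  rcases Bool.eq_or_eq_not o' o with rfl | rfl
  exacts [Or.inl h, Or.inr h]

theorem Shape.seg_along (h : Shape o p) {i j : Fin 4} (s : Seg p o i j) :
    (i = 0 ∧ j = 1 ∨ i = 1 ∧ j = 0) ∨ (i = 2 ∧ j = 3 ∨ i = 3 ∧ j = 2) ∧ p 1 (!o) ≠ p 2 (!o) := by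
  obtain ⟨-, h12, -, h23⟩ := h
  obtain ⟨hij, -, hlt⟩ := s
  fin_cases i <;> fin_cases j <;> grind

theorem Shape.seg_across (h : Shape o p) {i j : Fin 4} (s : Seg p (!o) i j) :
    i = 1 ∧ j = 2 ∨ i = 2 ∧ j = 1 := by
  obtain ⟨h01, -, h23, -⟩ := h
  obtain ⟨hij, -, hlt⟩ := s
  fin_cases i <;> fin_cases j <;> grind

theorem Shape.hasSeg_along (h : Shape o p) (s : HasSeg p o a l r) :
    a = p 1 (!o) ∧ l = min (p 0 o) (p 1 o) ∧ r = max (p 0 o) (p 1 o) ∨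
      a = p 2 (!o) ∧ l = min (p 2 o) (p 3 o) ∧ r = max (p 2 o) (p 3 o) ∧ p 1 (!o) ≠ p 2 (!o) := by
  obtain ⟨i, j, s, rfl, rfl, rfl⟩ := s
  have hlt := s.2.2
  rcases h.seg_along s with (⟨rfl, rfl⟩ | ⟨rfl, rfl⟩) | ⟨⟨rfl, rfl⟩ | ⟨rfl, rfl⟩, hne⟩ <;>
    obtain ⟨h01, -, h23, -⟩ := h <;> omega

theorem Shape.hasSeg_across (h : Shape o p) (s : HasSeg p (!o) a l r) :
    a = p 1 o ∧ l = min (p 1 (!o)) (p 2 (!o)) ∧ r = max (p 1 (!o)) (p 2 (!o)) := by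
  obtain ⟨i, j, s, rfl, rfl, rfl⟩ := s
  have hlt := s.2.2
  rw [Bool.not_not]
  rcases h.seg_across s with ⟨rfl, rfl⟩ | ⟨rfl, rfl⟩ <;> obtain ⟨-, h12, -, -⟩ := h <;> omega

theorem Shape.hasSeg_mid (h : Shape o p) (hne : p 1 (!o) ≠ p 2 (!o)) :
    HasSeg p (!o) (p 1 o) (min (p 1 (!o)) (p 2 (!o))) (max (p 1 (!o)) (p 2 (!o))) := by
  obtain ⟨-, h12, -, -⟩ := h
  rcases hne.lt_or_gt with hlt | hlt
  · exact ⟨1, 2, ⟨by decide, by simpa using h12, hlt⟩, by simp, by omega, by omega⟩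
  · exact ⟨2, 1, ⟨by decide, by simpa using h12.symm, hlt⟩, by simp [h12], by omega, by omega⟩

theorem Valid.hasSeg_unique (h : Valid p) (s : HasSeg p o a l r) (s' : HasSeg p o a L R) :
    l = L ∧ r = R := by
  rcases h.shape_or o with h | h
  · have := h.hasSeg_along s
    have := h.hasSeg_along s'
    omega
  · rw [← Bool.not_not o] at s s'
    have := h.hasSeg_across s
    have := h.hasSeg_across s'
    omega

theorem Valid.hasSeg_bend (h : Valid p) (s : HasSeg p o a l r) (s' : HasSeg p (!o) b L R) :
    (b = l ∨ b = r) ∧ (a = L ∨ a = R) := by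
  rcases h.shape_or o with h | h
  · have := h.hasSeg_along s
    have := h.hasSeg_across s'
    have := h.2.1
    omega
  · have := h.hasSeg_along s'
    rw [← Bool.not_not o] at s
    have := h.hasSeg_across s
    have := h.2.1
    simp only [Bool.not_not] at *
    omega

theorem Valid.overlap_iff (hp : Valid p) (hq : Valid q) (s : HasSeg p o a l r)
    (s' : HasSeg q o a L R) : Overlap p q o a ↔ l < R ∧ L < r := by
  refine ⟨?_, fun h => ⟨l, r, L, R, s, s', h⟩⟩
  rintro ⟨l', r', L', R', t, t', h⟩
  obtain ⟨rfl, rfl⟩ := hp.hasSeg_unique s t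
  obtain ⟨rfl, rfl⟩ := hq.hasSeg_unique s' t'
  exact h

/-- The path consists of the segments `[l, r]` on the line at `a` and `[l', r']` on the line at
`b`, both along `o`, and of a segment across at `c` that joins an end of the one to an end of the
other. -/
structure TwoArmed (p : Corners) (o : Bool) (a b l r l' r' c : ℤ) : Prop where
  fst : HasSeg p o a l r
  snd : HasSeg p o b l' r'
  across : HasSeg p (!o) c a b
  fst_end : c = l ∨ c = r
  snd_end : c = l' ∨ c = r'
  eq_of_uses_across : ∀ d, Uses p (!o) d → d = c
  eq_of_uses_along : ∀ d, Uses p o d → d = a ∨ d = b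

theorem Valid.exists_twoArmed (h : Valid p) (hab : a < b) (ha : Uses p o a) (hb : Uses p o b) :
    ∃ l r l' r' c, TwoArmed p o a b l r l' r' c := by
  obtain ⟨l, r, s⟩ := ha
  obtain ⟨l', r', s'⟩ := hb
  rcases h.shape_or o with hs | hs
  · have e := hs.hasSeg_along s
    have e' := hs.hasSeg_along s'
    have mid := hs.hasSeg_mid (by omega)
    have hmin : min (p 1 (!o)) (p 2 (!o)) = a := by omega
    have hmax : max (p 1 (!o)) (p 2 (!o)) = b := by omega
    rw [hmin, hmax] at mid
    refine ⟨l, r, l', r', p 1 o, s, s', mid, (h.hasSeg_bend s mid).1, (h.hasSeg_bend s' mid).1,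
      fun d ⟨_, _, t⟩ => (hs.hasSeg_across t).1, fun d ⟨_, _, t⟩ => ?_⟩
    have := hs.hasSeg_along t
    omega
  · rw [← Bool.not_not o] at s s'
    have := hs.hasSeg_across s
    have := hs.hasSeg_across s'
    omega

section TwoArmed

variable {l' r' c L' R' C : ℤ}

theorem TwoArmed.mem_snd (h : TwoArmed p o a b l r l' r' c) : l' ≤ c ∧ c ≤ r' := by
  have := h.snd.lt
  have := h.snd_end
  omega

theorem Valid.parallel_unique (h : Valid p) {o' : Bool} {a' b' : ℤ} (hab : a < b) (hab' : a' < b')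
    (ha : Uses p o a) (hb : Uses p o b) (ha' : Uses p o' a') (hb' : Uses p o' b') :
    o = o' ∧ a = a' ∧ b = b' := by
  obtain ⟨l, r, l', r', c, hd⟩ := h.exists_twoArmed hab ha hb
  rcases Bool.eq_or_eq_not o' o with rfl | rfl
  · have := hd.eq_of_uses_along _ ha'
    have := hd.eq_of_uses_along _ hb'
    exact ⟨rfl, by omega, by omega⟩
  · have h' := (hd.eq_of_uses_across _ ha').trans (hd.eq_of_uses_across _ hb').symm
    exact absurd h' hab'.ne

theorem TwoArmed.eq_of_overlap_across (hp : TwoArmed p o a b l r l' r' c)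
    (hq : TwoArmed q o a b L R L' R' C) {d : ℤ} (h : Overlap p q (!o) d) : c = C :=
  (hp.eq_of_uses_across d h.uses_left).symm.trans (hq.eq_of_uses_across d h.uses_right)

theorem TwoArmed.overlapNear_iff (vp : Valid p) (vq : Valid q) (hab : a < b)
    (hp : TwoArmed p o a b l r l' r' c) (hq : TwoArmed q o a b L R L' R' C) :
    OverlapNear p q o b ↔ (l' < R' ∧ L' < r') ∨ c = C := by
  rw [OverlapNear, vp.overlap_iff vq hp.snd hq.snd]
  refine or_congr_right ⟨fun ⟨d, h⟩ => hp.eq_of_overlap_across hq h, ?_⟩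
  rintro rfl
  exact ⟨c, a, b, a, b, hp.across, hq.across, hab, hab⟩

theorem TwoArmed.share_imp (vp : Valid p) (vq : Valid q) (hp : TwoArmed p o a b l r l' r' c)
    (hq : TwoArmed q o a b L R L' R' C) (h : Share p q) :
    (l < R ∧ L < r) ∨ (l' < R' ∧ L' < r') ∨ c = C := by
  obtain ⟨o', d, h⟩ := h
  rcases Bool.eq_or_eq_not o' o with rfl | rfl
  · rcases hp.eq_of_uses_along d h.uses_left with rfl | rfl
    · exact Or.inl ((vp.overlap_iff vq hp.fst hq.fst).1 h)
    · exact Or.inr (Or.inl ((vp.overlap_iff vq hp.snd hq.snd).1 h))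
  · exact Or.inr (Or.inr (hp.eq_of_overlap_across hq h))

end TwoArmed

end Corners

/-! ### Order types -/

section OrderType

open Corners

variable {V : Type*} {z : V → Corners}

/-- `u` and `x` have the same order type over `K`: their coordinates compare in the same way with
each other and with the coordinates of the elements of `K`. -/
def SameType (z : V → Corners) (K : Set V) (u x : V) : Prop :=
  (∀ i o j o', cmp (z u i o) (z u j o') = cmp (z x i o) (z x j o')) ∧
    ∀ k ∈ K, ∀ i o j o', cmp (z u i o) (z k j o') = cmp (z x i o) (z k j o')

/-- The set of the coordinates of the elements of `K`. -/
def coords (z : V → Corners) (K : Set V) : Set ℤ := {a | ∃ k ∈ K, ∃ j o, z k j o = a}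

theorem coords_mono {K K' : Set V} (h : K ⊆ K') : coords z K ⊆ coords z K' := by
  rintro a ⟨k, hk, j, o, e⟩
  exact ⟨k, h hk, j, o, e⟩

namespace SameType

variable {K K' : Set V} {u v x y : V}

theorem symm (h : SameType z K u x) : SameType z K x u :=
  ⟨fun i o j o' => (h.1 i o j o').symm, fun k hk i o j o' => (h.2 k hk i o j o').symm⟩

theorem trans (h : SameType z K u x) (h' : SameType z K x y) : SameType z K u y :=
  ⟨fun i o j o' => (h.1 i o j o').trans (h'.1 i o j o'),
    fun k hk i o j o' => (h.2 k hk i o j o').trans (h'.2 k hk i o j o')⟩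

theorem mono (h : SameType z K' u x) (hK : K ⊆ K') : SameType z K u x :=
  ⟨h.1, fun k hk => h.2 k (hK hk)⟩

theorem lt_iff (h : SameType z K u x) (i o j o') : z u i o < z u j o' ↔ z x i o < z x j o' := by
  rw [← cmp_eq_lt_iff, ← cmp_eq_lt_iff, h.1]

theorem eq_iff (h : SameType z K u x) (i o j o') : z u i o = z u j o' ↔ z x i o = z x j o' := by
  rw [← cmp_eq_eq_iff (z u i o), ← cmp_eq_eq_iff (z x i o), h.1]

theorem cmp_coord (h : SameType z K u x) {a : ℤ} (ha : a ∈ coords z K) (i o) :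
    cmp (z u i o) a = cmp (z x i o) a := by
  obtain ⟨k, hk, j, o', rfl⟩ := ha
  exact h.2 k hk i o j o'

theorem lt_coord_iff (h : SameType z K u x) {a : ℤ} (ha : a ∈ coords z K) (i o) :
    z u i o < a ↔ z x i o < a := by
  rw [← cmp_eq_lt_iff, ← cmp_eq_lt_iff, h.cmp_coord ha]

theorem coord_lt_iff (h : SameType z K u x) {a : ℤ} (ha : a ∈ coords z K) (i o) :
    a < z u i o ↔ a < z x i o := by
  rw [← cmp_eq_gt_iff, ← cmp_eq_gt_iff, h.cmp_coord ha]

theorem eq_coord_iff (h : SameType z K u x) {a : ℤ} (ha : a ∈ coords z K) (i o) :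
    z u i o = a ↔ z x i o = a := by
  rw [← cmp_eq_eq_iff (z u i o), ← cmp_eq_eq_iff (z x i o), h.cmp_coord ha]

theorem seg (h : SameType z K u x) {o : Bool} {i j : Fin 4} (s : (z x).Seg o i j) :
    (z u).Seg o i j :=
  ⟨s.1, (h.eq_iff _ _ _ _).2 s.2.1, (h.lt_iff _ _ _ _).2 s.2.2⟩

theorem exists_hasSeg (h : SameType z K u x) {o : Bool} {a l r : ℤ} (ha : a ∈ coords z K)
    (s : (z x).HasSeg o a l r) :
    ∃ l' r', (z u).HasSeg o a l' r' ∧ ∀ b ∈ coords z K, (l' < b ↔ l < b) ∧ (r' < b ↔ r < b) := by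
  obtain ⟨i, j, s, e, rfl, rfl⟩ := s
  exact ⟨_, _, ⟨i, j, h.seg s, (h.eq_coord_iff ha _ _).2 e, rfl, rfl⟩, fun b hb =>
    ⟨h.lt_coord_iff hb _ _, h.lt_coord_iff hb _ _⟩⟩

theorem uses (h : SameType z K u x) {o : Bool} {a : ℤ} (ha : a ∈ coords z K)
    (hx : (z x).Uses o a) : (z u).Uses o a := by
  obtain ⟨l, r, s⟩ := hx
  obtain ⟨l', r', s', -⟩ := h.exists_hasSeg ha s
  exact ⟨l', r', s'⟩

/-- The segments across of `u` and of `v` leave the common line on the same side, since those of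
`x` and of `y` do. -/
theorem share_of_overlap_across (hu : SameType z K u x) (hv : SameType z K' v y)
    (hx : Valid (z x)) (hy : Valid (z y)) {o : Bool} {i j k l f g : Fin 4}
    (sx : Seg (z x) o i j) (sy : Seg (z y) o k l) (hline : z x i (!o) = z y k (!o))
    (hline' : z u i (!o) = z v k (!o)) (hover : Overlap (z x) (z y) (!o) (z x f o))
    (hend : z x f o = z y g o) (hend' : z u f o = z v g o) : Share (z u) (z v) := by
  obtain ⟨s, t, S, T, hs, hS, h, h'⟩ := hover
  have bx := (hx.hasSeg_bend sx.hasSeg hs).2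
  have by' := (hy.hasSeg_bend sy.hasSeg hS).2
  obtain ⟨m, m', s1, e1, rfl, rfl⟩ := hs
  obtain ⟨n, n', s2, e2, rfl, rfl⟩ := hS
  rw [Bool.not_not] at e1 e2
  have t1 := hu.seg s1
  have t2 := hv.seg s2
  have eu := (hu.eq_iff m o f o).2 e1
  have ev := (hv.eq_iff n o g o).2 (e2.trans hend)
  have := s1.2.2
  have := s2.2.2
  have := t1.2.2
  have := t2.2.2
  have := hu.eq_iff m (!o) i (!o)
  have := hu.eq_iff m' (!o) i (!o)
  have := hv.eq_iff n (!o) k (!o)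
  have := hv.eq_iff n' (!o) k (!o)
  refine ⟨!o, z u f o, _, _, _, _, ⟨m, m', t1, by simpa using eu, rfl, rfl⟩,
    ⟨n, n', t2, by simpa using ev.trans hend'.symm, rfl, rfl⟩, ?_, ?_⟩ <;> omega

end SameType

/-- `K'` extends `K`, and within `C` it contains elements with extreme coordinates of every
order type over `K`. -/
structure Extremal (z : V → Corners) (C K K' : Set V) : Prop where
  subset : K ⊆ K'
  subset_clique : K' ⊆ C
  min : ∀ x ∈ C, ∀ i o, ∃ x' ∈ K', SameType z K x' x ∧ z x' i o ≤ z x i o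
  max : ∀ x ∈ C, ∀ i o, ∃ x' ∈ K', SameType z K x' x ∧ z x i o ≤ z x' i o

namespace Extremal

variable {C K K' : Set V} {x y u v : V} {o : Bool} {a : ℤ} {i j k l : Fin 4}

/-- If `x'` and `y` have an edge in common only across the line, at their ends `f` and `g`, then
these are also the same for `u` and `v`, which have an edge in common there as well. -/
theorem share_of_common_end (hK : Extremal z C K K') (hz : ∀ v, Valid (z v)) {x' : V}
    (hx' : x' ∈ K') (hs : SameType z K x' x) (sx : Seg (z x) o i j) (sy : Seg (z y) o k l)
    (ha : a ∈ coords z K) (ex : z x i (!o) = a) (ey : z y k (!o) = a)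
    (hnear : OverlapNear (z x') (z y) o a) (hno : ¬ (z x' i o < z y l o ∧ z y k o < z x' j o))
    (hu : SameType z K' u x) (hv : SameType z K' v y) {f g : Fin 4}
    (hend : ∀ b, b = z x' i o ∨ b = z x' j o → b = z y k o ∨ b = z y l o →
      b = z x' f o ∧ b = z y g o)
    (huf : z v g o = z x' f o → z u f o = z x' f o) : Share (z u) (z v) := by
  have ha' := coords_mono hK.subset ha
  have sx' := hs.seg sx
  have ex' := (hs.eq_coord_iff ha _ _).2 ex
  rw [← (hz x').overlap_iff (hz y) (ex' ▸ sx'.hasSeg) (ey ▸ sy.hasSeg)] at hno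
  obtain ⟨b, hb⟩ := hnear.resolve_left hno
  obtain ⟨s, t, h⟩ := hb.uses_left
  obtain ⟨S, T, h'⟩ := hb.uses_right
  obtain ⟨rfl, hbg⟩ :=
    hend b ((hz x').hasSeg_bend sx'.hasSeg h).1 ((hz y).hasSeg_bend sy.hasSeg h').1
  have hvg := (hv.eq_coord_iff ⟨x', hx', f, o, rfl⟩ g o).2 hbg.symm
  exact ((hu.mono hK.subset).trans hs.symm).share_of_overlap_across hv (hz x') (hz y) sx' sy
    (ex'.trans ey.symm)
    (((hu.eq_coord_iff ha' _ _).2 ex).trans ((hv.eq_coord_iff ha' _ _).2 ey).symm)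
    hb hbg ((huf hvg).trans hvg.symm)

/-- If `u` ends before `v` starts, then the element of `K'` that ends first meets `y` at most at
its last point, which is then also the last point of `u` and the first one of `v`. -/
theorem share_of_left (hK : Extremal z C K K') (hz : ∀ v, Valid (z v)) (hx : x ∈ C)
    (sx : Seg (z x) o i j) (sy : Seg (z y) o k l) (ha : a ∈ coords z K)
    (ex : z x i (!o) = a) (ey : z y k (!o) = a)
    (H : ∀ x' ∈ K', SameType z K x' x → OverlapNear (z x') (z y) o a)
    (hu : SameType z K' u x) (hv : SameType z K' v y) (hd : z u j o ≤ z v k o) :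
    Share (z u) (z v) := by
  obtain ⟨x', hx', hs, hle⟩ := hK.min x hx j o
  have hp : z x' j o ∈ coords z K' := ⟨x', hx', j, o, rfl⟩
  have huj : z x' j o ≤ z u j o := not_lt.1 fun h => hle.not_gt ((hu.lt_coord_iff hp _ _).1 h)
  have hyk : z x' j o ≤ z y k o :=
    not_lt.1 fun h => (huj.trans hd).not_gt ((hv.lt_coord_iff hp _ _).2 h)
  have hlt := (hs.seg sx).2.2
  have hlt' := sy.2.2
  exact hK.share_of_common_end hz hx' hs sx sy ha ex ey (H x' hx' hs) (by omega) hu hv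
    (f := j) (g := k) (by omega) (by omega)

theorem share_of_right (hK : Extremal z C K K') (hz : ∀ v, Valid (z v)) (hx : x ∈ C)
    (sx : Seg (z x) o i j) (sy : Seg (z y) o k l) (ha : a ∈ coords z K)
    (ex : z x i (!o) = a) (ey : z y k (!o) = a)
    (H : ∀ x' ∈ K', SameType z K x' x → OverlapNear (z x') (z y) o a)
    (hu : SameType z K' u x) (hv : SameType z K' v y) (hd : z v l o ≤ z u i o) :
    Share (z u) (z v) := by
  obtain ⟨x', hx', hs, hle⟩ := hK.max x hx i o
  have hp : z x' i o ∈ coords z K' := ⟨x', hx', i, o, rfl⟩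
  have hui : z u i o ≤ z x' i o := not_lt.1 fun h => hle.not_gt ((hu.coord_lt_iff hp _ _).1 h)
  have hyl : z y l o ≤ z x' i o :=
    not_lt.1 fun h => (hd.trans hui).not_gt ((hv.coord_lt_iff hp _ _).2 h)
  have hlt := (hs.seg sx).2.2
  have hlt' := sy.2.2
  exact hK.share_of_common_end hz hx' hs sx sy ha ex ey (H x' hx' hs) (by omega) hu hv
    (f := i) (g := l) (by omega) (by omega)

theorem share (hK : Extremal z C K K') (hz : ∀ v, Valid (z v)) (hx : x ∈ C) (ha : a ∈ coords z K)
    (hxa : Uses (z x) o a) (hya : Uses (z y) o a)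
    (H : ∀ x' ∈ K', SameType z K x' x → OverlapNear (z x') (z y) o a)
    (hu : SameType z K' u x) (hv : SameType z K' v y) : Share (z u) (z v) := by
  have ha' := coords_mono hK.subset ha
  obtain ⟨_, _, i, j, sx, ex, -⟩ := hxa
  obtain ⟨_, _, k, l, sy, ey, -⟩ := hya
  rcases le_or_gt (z u j o) (z v k o) with h | h
  · exact hK.share_of_left hz hx sx sy ha ex ey H hu hv h
  rcases le_or_gt (z v l o) (z u i o) with h' | h'
  · exact hK.share_of_right hz hx sx sy ha ex ey H hu hv h'
  exact ⟨o, a, _, _, _, _, ⟨i, j, hu.seg sx, (hu.eq_coord_iff ha' _ _).2 ex, rfl, rfl⟩,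
    ⟨k, l, hv.seg sy, (hv.eq_coord_iff ha' _ _).2 ey, rfl, rfl⟩, h', h⟩

theorem share_or_parallel (hK : Extremal z C K K') (hz : ∀ v, Valid (z v))
    (hC : ∀ x ∈ C, ∀ y ∈ C, Share (z x) (z y)) (hx : x ∈ C) (hy : y ∈ C)
    (stable : ∀ i o, z y i o ∈ coords z K' → z y i o ∈ coords z K)
    (hu : SameType z K' u x) (hv : SameType z K' v y) :
    Share (z u) (z v) ∨ ∃ o a b, a < b ∧ a ∈ coords z K ∧ b ∈ coords z K ∧
      Uses (z x) o a ∧ Uses (z x) o b ∧ Uses (z y) o a ∧ Uses (z y) o b := by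
  have common : ∀ x' ∈ K', SameType z K x' x → ∀ o a, Overlap (z x') (z y) o a →
      a ∈ coords z K ∧ Uses (z x) o a ∧ Uses (z y) o a := by
    rintro x' hx' hs o a h
    obtain ⟨_, _, i, _, _, e1, -⟩ := h.uses_left
    obtain ⟨_, _, j, _, _, e2, -⟩ := h.uses_right
    have ha : a ∈ coords z K := e2 ▸ stable j (!o) ⟨x', hx', i, !o, e1.trans e2.symm⟩
    exact ⟨ha, hs.symm.uses ha h.uses_left, h.uses_right⟩
  obtain ⟨x₀, hx₀, hs₀, -⟩ := hK.min x hx 0 true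
  obtain ⟨o, a, ho⟩ := hC x₀ (hK.subset_clique hx₀) y hy
  obtain ⟨ha, hxa, hya⟩ := common x₀ hx₀ hs₀ o a ho
  by_cases H : ∀ x' ∈ K', SameType z K x' x → OverlapNear (z x') (z y) o a
  · exact Or.inl (hK.share hz hx ha hxa hya H hu hv)
  push Not at H
  obtain ⟨x', hx', hs, hn⟩ := H
  obtain ⟨o', b, hb⟩ := hC x' (hK.subset_clique hx') y hy
  rcases Bool.eq_or_eq_not o' o with rfl | rfl
  · obtain ⟨hb', hxb, hyb⟩ := common x' hx' hs _ _ hb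
    have hne : a ≠ b := by
      rintro rfl
      exact hn (Or.inl hb)
    rcases hne.lt_or_gt with hlt | hlt
    · exact Or.inr ⟨o', a, b, hlt, ha, hb', hxa, hxb, hya, hyb⟩
    · exact Or.inr ⟨o', b, a, hlt, hb', ha, hxb, hxa, hyb, hya⟩
  · exact absurd (Or.inr ⟨b, hb⟩) hn

end Extremal

end OrderType

/-! ### Pivots -/

namespace Corners

/-- The intervals are the segments of paths on a line, and the marked points are those at which the
paths leave it: if two of them agree, then the paths have an edge across the line in common. -/
theorem interval_overlap_of_near {l r c L R C l₁ r₁ c₁ l₂ r₂ c₂ : ℤ}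
    (hc : l ≤ c ∧ c ≤ r) (hC : L ≤ C ∧ C ≤ R) (hc₁ : l₁ ≤ c₁ ∧ c₁ ≤ r₁) (hc₂ : l₂ ≤ c₂ ∧ c₂ ≤ r₂)
    (hd : r₁ ≤ l₂) (h₁ : (l < r₁ ∧ l₁ < r) ∨ c = c₁) (h₂ : (l < r₂ ∧ l₂ < r) ∨ c = c₂)
    (H₁ : (L < r₁ ∧ l₁ < R) ∨ C = c₁) (H₂ : (L < r₂ ∧ l₂ < R) ∨ C = c₂) :
    (l < R ∧ L < r) ∨ c = C := by
  omega

theorem overlapNear_of_share {p q s t : Corners} (hp : Valid p) (hq : Valid q) (hs : Valid s)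
    (ht : Valid t) {o : Bool} {a b : ℤ} (hab : a < b) (pa : Uses p o a) (pb : Uses p o b)
    (qa : Uses q o a) (qb : Uses q o b) (sa : Uses s o a) (sb : Uses s o b) (ta : Uses t o a)
    (tb : Uses t o b) (hps : Share p s) (hpt : Share p t) (hqs : Share q s) (hqt : Share q t)
    (nps : ¬ Overlap p s o a) (npt : ¬ Overlap p t o a) (nqs : ¬ Overlap q s o a)
    (nqt : ¬ Overlap q t o a) (hst : ¬ OverlapNear s t o b) : OverlapNear p q o b := by
  obtain ⟨l, r, l', r', c, dp⟩ := hp.exists_twoArmed hab pa pb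
  obtain ⟨L, R, L', R', C, dq⟩ := hq.exists_twoArmed hab qa qb
  obtain ⟨l₁, r₁, l₁', r₁', c₁, ds⟩ := hs.exists_twoArmed hab sa sb
  obtain ⟨l₂, r₂, l₂', r₂', c₂, dt⟩ := ht.exists_twoArmed hab ta tb
  rw [hp.overlap_iff hs dp.fst ds.fst] at nps
  rw [hp.overlap_iff ht dp.fst dt.fst] at npt
  rw [hq.overlap_iff hs dq.fst ds.fst] at nqs
  rw [hq.overlap_iff ht dq.fst dt.fst] at nqt
  rw [ds.overlapNear_iff hs ht hab dt] at hst
  rw [dp.overlapNear_iff hp hq hab dq]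
  have ps := (dp.share_imp hp hs ds hps).resolve_left nps
  have pt := (dp.share_imp hp ht dt hpt).resolve_left npt
  have qs := (dq.share_imp hq hs ds hqs).resolve_left nqs
  have qt := (dq.share_imp hq ht dt hqt).resolve_left nqt
  rcases show r₁' ≤ l₂' ∨ r₂' ≤ l₁' by omega with h | h
  · exact interval_overlap_of_near dp.mem_snd dq.mem_snd ds.mem_snd dt.mem_snd h ps pt qs qt
  · exact interval_overlap_of_near dp.mem_snd dq.mem_snd dt.mem_snd ds.mem_snd h pt ps qt qs

end Corners

section Pivot

open Corners

variable {V : Type*} {z : V → Corners} {C K K' K'' : Set V} {o : Bool} {a b p : ℤ} {x y u v : V}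

/-- The right ends, on the line at `a`, of the elements of `C` that do not overlap near the line
at `b` with some element ending no later at `a`. Its least element is the pivot: two elements of
`C` that both end before it overlap near the line at `b`. -/
def pivotSet (z : V → Corners) (C : Set V) (o : Bool) (a b : ℤ) : Set ℤ :=
  {r | ∃ x ∈ C, ∃ y ∈ C, ∃ l L R, HasSeg (z x) o a l r ∧ HasSeg (z y) o a L R ∧ R ≤ r ∧
    Uses (z x) o b ∧ Uses (z y) o b ∧ ¬ OverlapNear (z x) (z y) o b}

/-- On the line along `o` at `a`, the path of `x` contains the edge to the left of the pivot. -/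
def SpansPivot (z : V → Corners) (C : Set V) (o : Bool) (a b : ℤ) (x : V) : Prop :=
  ∃ l r p, HasSeg (z x) o a l r ∧ IsLeast (pivotSet z C o a b) p ∧ l < p ∧ p ≤ r

/-- On the first of the two parallel lines that it uses, at coordinates of `K`, the path of `x`
contains the edge to the left of the pivot. -/
def ContainsPivot (z : V → Corners) (C K : Set V) (x : V) : Prop :=
  ∃ o a b, a < b ∧ a ∈ coords z K ∧ b ∈ coords z K ∧ Uses (z x) o b ∧ SpansPivot z C o a b x

/-- `K'` contains `K` and the elements of `C` at the pivots of the lines at the coordinates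
of `K`. -/
structure Pivotal (z : V → Corners) (C K K' : Set V) : Prop where
  subset : K ⊆ K'
  subset_clique : K' ⊆ C
  pivot : ∀ o a b p, a ∈ coords z K → b ∈ coords z K → IsLeast (pivotSet z C o a b) p →
    p ∈ coords z K'

theorem exists_isLeast_pivotSet [Finite V] (h : (pivotSet z C o a b).Nonempty) :
    ∃ p, IsLeast (pivotSet z C o a b) p := by
  have hf : (pivotSet z C o a b).Finite := by
    refine (Set.finite_range fun t : V × Fin 4 => z t.1 t.2 o).subset ?_
    rintro r ⟨x, -, y, -, l, L, R, ⟨i, j, -, -, -, e⟩, -⟩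
    exact ⟨(x, j), e⟩
  exact hf.isCompact.exists_isLeast h

theorem max_mem_pivotSet (hx : x ∈ C) (hy : y ∈ C) {l r L R : ℤ} (sx : HasSeg (z x) o a l r)
    (sy : HasSeg (z y) o a L R) (xb : Uses (z x) o b) (yb : Uses (z y) o b)
    (hn : ¬ OverlapNear (z x) (z y) o b) : max r R ∈ pivotSet z C o a b := by
  rcases le_total R r with h | h
  · rw [max_eq_left h]
    exact ⟨x, hx, y, hy, l, L, R, sx, sy, h, xb, yb, hn⟩
  · rw [max_eq_right h]
    exact ⟨y, hy, x, hx, L, l, r, sy, sx, h, yb, xb, fun h => hn h.symm⟩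

theorem containsPivot_iff (hz : Valid (z x)) (hab : a < b) (ha : a ∈ coords z K)
    (hb : b ∈ coords z K) (xa : Uses (z x) o a) (xb : Uses (z x) o b) :
    ContainsPivot z C K x ↔ SpansPivot z C o a b x := by
  refine ⟨?_, fun h => ⟨o, a, b, hab, ha, hb, xb, h⟩⟩
  rintro ⟨o', a', b', hab', -, -, xb', h⟩
  obtain ⟨l, r, p, s, -⟩ := id h
  obtain ⟨rfl, rfl, rfl⟩ := hz.parallel_unique hab hab' xa xb ⟨l, r, s⟩ xb'
  exact h

theorem SpansPivot.overlap (hx : SpansPivot z C o a b x) (hy : SpansPivot z C o a b y) :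
    Overlap (z x) (z y) o a := by
  obtain ⟨l, r, p, sx, hp, h, h'⟩ := hx
  obtain ⟨L, R, q, sy, hq, H, H'⟩ := hy
  obtain rfl := hp.unique hq
  exact ⟨l, r, L, R, sx, sy, h.trans_le H', H.trans_le h'⟩

theorem SameType.spansPivot (h : SameType z K u x) (ha : a ∈ coords z K)
    (hpivot : ∀ p, IsLeast (pivotSet z C o a b) p → p ∈ coords z K)
    (hx : SpansPivot z C o a b x) : SpansPivot z C o a b u := by
  obtain ⟨l, r, p, s, hp, h1, h2⟩ := hx
  obtain ⟨l', r', s', hcmp⟩ := h.exists_hasSeg ha s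
  obtain ⟨hl, hr⟩ := hcmp p (hpivot p hp)
  exact ⟨l', r', p, s', hp, hl.2 h1, not_lt.1 fun hlt => h2.not_gt (hr.1 hlt)⟩

/-- Otherwise `x` and `y` lie to the right of the pivot on the line at `a`, whereas the two elements
that define the pivot lie to its left. -/
theorem overlapNear_of_not_spansPivot [Finite V] (hz : ∀ v, Valid (z v))
    (hC : ∀ x ∈ C, ∀ y ∈ C, Share (z x) (z y)) (hab : a < b) (hx : x ∈ C) (hy : y ∈ C)
    (xa : Uses (z x) o a) (xb : Uses (z x) o b) (ya : Uses (z y) o a) (yb : Uses (z y) o b)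
    (nx : ¬ SpansPivot z C o a b x) (ny : ¬ SpansPivot z C o a b y) :
    OverlapNear (z x) (z y) o b := by
  by_contra hn
  obtain ⟨l, r, sx⟩ := id xa
  obtain ⟨L, R, sy⟩ := id ya
  have hmax := max_mem_pivotSet hx hy sx sy xb yb hn
  obtain ⟨p, hp⟩ := exists_isLeast_pivotSet ⟨_, hmax⟩
  have hle : p ≤ max r R := hp.2 hmax
  have hxp : r < p ∨ p ≤ l := by
    by_contra! h
    exact nx ⟨l, r, p, sx, hp, h.2, h.1⟩
  have hyp : R < p ∨ p ≤ L := by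
    by_contra! h
    exact ny ⟨L, R, p, sy, hp, h.2, h.1⟩
  have hxy : l < R ∧ L < r := by
    rw [← (hz x).overlap_iff (hz y) sx sy]
    obtain ⟨o', d, h⟩ := hC x hx y hy
    obtain ⟨_, _, _, _, c, dx⟩ := (hz x).exists_twoArmed hab xa xb
    rcases Bool.eq_or_eq_not o' o with rfl | rfl
    · rcases dx.eq_of_uses_along d h.uses_left with rfl | rfl
      exacts [h, absurd (Or.inl h) hn]
    · exact absurd (Or.inr ⟨d, h⟩) hn
  obtain ⟨s, hs, t, ht, l₁, l₂, r₂, ss, st, hr, sb, tb, hst⟩ := hp.1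
  refine hn (overlapNear_of_share (hz x) (hz y) (hz s) (hz t) hab xa xb ya yb ⟨_, _, ss⟩ sb
    ⟨_, _, st⟩ tb (hC x hx s hs) (hC x hx t ht) (hC y hy s hs) (hC y hy t ht) ?_ ?_ ?_ ?_ hst)
  · rw [(hz x).overlap_iff (hz s) sx ss]
    omega
  · rw [(hz x).overlap_iff (hz t) sx st]
    omega
  · rw [(hz y).overlap_iff (hz s) sy ss]
    omega
  · rw [(hz y).overlap_iff (hz t) sy st]
    omega

theorem Pivotal.share [Finite V] (hK : Pivotal z C K K') (hK' : Extremal z C K' K'')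
    (hz : ∀ v, Valid (z v)) (hC : ∀ x ∈ C, ∀ y ∈ C, Share (z x) (z y)) (hx : x ∈ C) (hy : y ∈ C)
    (hxy : ContainsPivot z C K x ↔ ContainsPivot z C K y)
    (hu : SameType z K'' u x) (hv : SameType z K'' v y) (hab : a < b)
    (ha : a ∈ coords z K) (hb : b ∈ coords z K) (xa : Uses (z x) o a) (xb : Uses (z x) o b)
    (ya : Uses (z y) o a) (yb : Uses (z y) o b) : Share (z u) (z v) := by
  rw [containsPivot_iff (hz x) hab ha hb xa xb, containsPivot_iff (hz y) hab ha hb ya yb] at hxy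
  have ha' := coords_mono hK.subset ha
  have hb' := coords_mono hK.subset hb
  have hpivot := fun p => hK.pivot o a b p ha hb
  by_cases h : SpansPivot z C o a b x
  · exact ⟨o, a, ((hu.mono hK'.subset).spansPivot ha' hpivot h).overlap
      ((hv.mono hK'.subset).spansPivot ha' hpivot (hxy.1 h))⟩
  · refine hK'.share hz hx hb' xb yb (fun x' hx' hs => ?_) hu hv
    exact overlapNear_of_not_spansPivot hz hC hab (hK'.subset_clique hx') hy (hs.uses ha' xa)
      (hs.uses hb' xb) ya yb (fun h' => h (hs.symm.spansPivot ha' hpivot h')) fun h' => h (hxy.2 h')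

end Pivot

/-! ### Covering a clique by two unions of order types -/

section Cover

open Corners

/-- The order types over families of `m` paths. -/
abbrev Pattern (m : ℕ) : Type :=
  (Fin 4 → Bool → Fin 4 → Bool → Ordering) × (Fin m → Fin 4 → Bool → Fin 4 → Bool → Ordering)

variable {V : Type*} {z : V → Corners} {C : Set V} {m : ℕ} {f : Fin m → V}

/-- The order type of `v` over the family `f`. -/
def pattern (z : V → Corners) (f : Fin m → V) (v : V) : Pattern m :=
  (fun i o j o' => cmp (z v i o) (z v j o'), fun k i o j o' => cmp (z v i o) (z (f k) j o'))

theorem pattern_eq_iff {u v : V} :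
    pattern z f u = pattern z f v ↔ SameType z (Set.range f) u v := by
  simp only [pattern, Prod.mk.injEq, funext_iff, SameType, Set.forall_mem_range]

theorem exists_family_extension (hC : C.Nonempty) (hf : Set.range f ⊆ C) {ι : Type*} [Finite ι]
    (P : ι → V → Prop) : ∃ f' : Fin (m + Nat.card ι) → V, Set.range f ⊆ Set.range f' ∧
      Set.range f' ⊆ C ∧ ∀ t, (∃ x ∈ C, P t x) → ∃ x ∈ Set.range f', P t x := by
  obtain ⟨x₀, hx₀⟩ := hC
  have hP : ∀ t, ∃ x ∈ C, (∃ y ∈ C, P t y) → P t x := by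
    intro t
    by_cases h : ∃ x ∈ C, P t x
    · exact h.imp fun x hx => ⟨hx.1, fun _ => hx.2⟩
    · exact ⟨x₀, hx₀, fun h' => absurd h' h⟩
  choose g hgC hg using hP
  refine ⟨Sum.elim f (g ∘ (Finite.equivFin ι).symm) ∘ finSumFinEquiv.symm, ?_⟩
  rw [EquivLike.range_comp, Set.Sum.elim_range, EquivLike.range_comp]
  exact ⟨Set.subset_union_left, Set.union_subset hf (Set.range_subset_iff.2 hgC),
    fun t ht => ⟨g t, Or.inr ⟨t, rfl⟩, hg t ht⟩⟩

theorem exists_extremal (m : ℕ) : ∃ m', ∀ {V : Type*} [Finite V] (z : V → Corners) (C : Set V)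
    (f : Fin m → V), C.Nonempty → Set.range f ⊆ C →
      ∃ f' : Fin m' → V, Extremal z C (Set.range f) (Set.range f') := by
  refine ⟨m + Nat.card (Pattern m × Fin 4 × Bool) + Nat.card (Pattern m × Fin 4 × Bool),
    fun {V} _ z C f hC hf => ?_⟩
  obtain ⟨f₁, hff₁, hf₁, hmin⟩ := exists_family_extension hC hf
    fun (t : Pattern m × Fin 4 × Bool) x => pattern z f x = t.1 ∧
      ∀ y ∈ C, pattern z f y = t.1 → z x t.2.1 t.2.2 ≤ z y t.2.1 t.2.2
  obtain ⟨f₂, hff₂, hf₂, hmax⟩ := exists_family_extension hC hf₁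
    fun (t : Pattern m × Fin 4 × Bool) x => pattern z f x = t.1 ∧
      ∀ y ∈ C, pattern z f y = t.1 → z y t.2.1 t.2.2 ≤ z x t.2.1 t.2.2
  refine ⟨f₂, hff₁.trans hff₂, hf₂, fun x hx i o => ?_, fun x hx i o => ?_⟩
  · obtain ⟨y, hy, hle⟩ := Set.exists_min_image {y ∈ C | pattern z f y = pattern z f x}
      (z · i o) (Set.toFinite _) ⟨x, hx, rfl⟩
    obtain ⟨x', hx', he, hle'⟩ := hmin (pattern z f x, i, o)
      ⟨y, hy.1, hy.2, fun y' hy' he => hle y' ⟨hy', he⟩⟩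
    exact ⟨x', hff₂ hx', pattern_eq_iff.1 he, hle' x hx rfl⟩
  · obtain ⟨y, hy, hle⟩ := Set.exists_max_image {y ∈ C | pattern z f y = pattern z f x}
      (z · i o) (Set.toFinite _) ⟨x, hx, rfl⟩
    obtain ⟨x', hx', he, hle'⟩ := hmax (pattern z f x, i, o)
      ⟨y, hy.1, hy.2, fun y' hy' he => hle y' ⟨hy', he⟩⟩
    exact ⟨x', hx', pattern_eq_iff.1 he, hle' x hx rfl⟩

theorem exists_pivotal (m : ℕ) : ∃ m', ∀ {V : Type*} (z : V → Corners) (C : Set V)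
    (f : Fin m → V), C.Nonempty → Set.range f ⊆ C →
      ∃ f' : Fin m' → V, Pivotal z C (Set.range f) (Set.range f') := by
  refine ⟨m + Nat.card (Bool × (Fin m × Fin 4 × Bool) × (Fin m × Fin 4 × Bool)),
    fun {V} z C f hC hf => ?_⟩
  obtain ⟨f', hff', hf', hpivot⟩ := exists_family_extension hC hf
    fun (t : Bool × (Fin m × Fin 4 × Bool) × (Fin m × Fin 4 × Bool)) x =>
      match t with
      | (o, (k, i, o₁), (k', i', o₂)) =>
        ∃ j, IsLeast (pivotSet z C o (z (f k) i o₁) (z (f k') i' o₂)) (z x j o)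
  refine ⟨f', hff', hf', ?_⟩
  rintro o _ _ p ⟨_, ⟨k, rfl⟩, i, o₁, rfl⟩ ⟨_, ⟨k', rfl⟩, i', o₂, rfl⟩ hp
  obtain ⟨y, hy, -, -, -, -, -, ⟨-, j, -, -, -, hj⟩, -⟩ := id hp.1
  obtain ⟨x, hx, j', hj'⟩ := hpivot (o, (k, i, o₁), (k', i', o₂)) ⟨y, hy, j, hj ▸ hp⟩
  exact ⟨x, hx, j', o, hj'.unique hp⟩

theorem exists_extremal_chain : ∃ m : ℕ → ℕ, ∀ {V : Type*} [Finite V] (z : V → Corners)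
    (C : Set V), C.Nonempty → ∃ f : ∀ t, Fin (m t) → V,
      ∀ t, Extremal z C (Set.range (f t)) (Set.range (f (t + 1))) := by
  choose next hnext using exists_extremal
  refine ⟨fun t => Nat.rec 1 (fun _ => next) t, fun {V} _ z C hC => ?_⟩
  choose g hg using fun m f => hnext m z C f hC
  obtain ⟨x₀, hx₀⟩ := hC
  let F : ∀ t, {f : Fin (Nat.rec 1 (fun _ => next) t) → V // Set.range f ⊆ C} := fun t =>
    Nat.rec ⟨fun _ => x₀, Set.range_subset_iff.2 fun _ => hx₀⟩
      (fun _ f => ⟨g _ f.1 f.2, (hg _ f.1 f.2).subset_clique⟩) t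
  exact ⟨fun t => (F t).1, fun t => hg _ (F t).1 (F t).2⟩

theorem exists_eq_succ_of_monotone {α : Type*} [Finite α] {S : ℕ → Set α} (hS : Monotone S) :
    ∃ t ≤ Nat.card α, S t = S (t + 1) := by
  by_contra! h
  have hcard : ∀ t ≤ Nat.card α + 1, t ≤ (S t).ncard := by
    intro t ht
    induction t with
    | zero => exact zero_le
    | succ t ih =>
      have hss : S t ⊂ S (t + 1) := (hS t.le_succ).ssubset_of_ne (h t (by omega))
      exact (ih (by omega)).trans_lt (Set.ncard_lt_ncard hss)
  have := (hcard _ le_rfl).trans (Set.ncard_le_card _)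
  omega

/-- The coordinates of `y` that are among those of `K t` form a monotone sequence of subsets of a
set of eight elements, so that the step from `K t` to `K (t + 1)` adds none for some `t ≤ 8`. -/
theorem share_of_extremal_chain [Finite V] {K : ℕ → Set V} {K' K'' : Set V} (hz : ∀ v, Valid (z v))
    (hC : ∀ x ∈ C, ∀ y ∈ C, Share (z x) (z y)) (hK : ∀ t, Extremal z C (K t) (K (t + 1)))
    (hK' : Pivotal z C (K 9) K') (hK'' : Extremal z C K' K'') {x y u v : V} (hx : x ∈ C)
    (hy : y ∈ C) (hxy : ContainsPivot z C (K 9) x ↔ ContainsPivot z C (K 9) y)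
    (hu : SameType z K'' u x) (hv : SameType z K'' v y) : Share (z u) (z v) := by
  have mono : Monotone K := monotone_nat_of_le_succ fun t => (hK t).subset
  obtain ⟨t, ht, hs⟩ := exists_eq_succ_of_monotone
    (S := fun t => {e : Fin 4 × Bool | z y e.1 e.2 ∈ coords z (K t)})
    fun s t hst e he => coords_mono (mono hst) he
  replace ht : t ≤ 8 := by simpa using ht
  have hsub : K (t + 1) ⊆ K'' := ((mono (by omega)).trans hK'.subset).trans hK''.subset
  rcases (hK t).share_or_parallel hz hC hx hy (fun i o h => (Set.ext_iff.1 hs (i, o)).2 h)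
    (hu.mono hsub) (hv.mono hsub) with h | ⟨o, a, b, hab, ha, hb, xa, xb, ya, yb⟩
  · exact h
  · have h9 : coords z (K t) ⊆ coords z (K 9) := coords_mono (mono (by omega))
    exact hK'.share hK'' hz hC hx hy hxy hu hv hab (h9 ha) (h9 hb) xa xb ya yb

theorem exists_pattern_cover : ∃ m, ∀ {V : Type*} [Finite V] (z : V → Corners) (C : Set V),
    C.Nonempty → (∀ v, Valid (z v)) → (∀ x ∈ C, ∀ y ∈ C, Share (z x) (z y)) →
      ∃ (f : Fin m → V) (S T : Set (Pattern m)),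
        (∀ x ∈ C, pattern z f x ∈ S ∨ pattern z f x ∈ T) ∧
        (∀ u v, pattern z f u ∈ S → pattern z f v ∈ S → Share (z u) (z v)) ∧
        (∀ u v, pattern z f u ∈ T → pattern z f v ∈ T → Share (z u) (z v)) := by
  obtain ⟨m₁, h₁⟩ := exists_extremal_chain
  obtain ⟨m₂, h₂⟩ := exists_pivotal (m₁ 9)
  obtain ⟨m₃, h₃⟩ := exists_extremal m₂
  refine ⟨m₃, fun {V} _ z C hne hz hC => ?_⟩
  obtain ⟨f₁, hf₁⟩ := h₁ z C hne
  obtain ⟨f₂, hf₂⟩ := h₂ z C (f₁ 9) hne (hf₁ 8).subset_clique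
  obtain ⟨f₃, hf₃⟩ := h₃ z C f₂ hne hf₂.subset_clique
  have share : ∀ D ⊆ C, (∀ x ∈ D, ∀ y ∈ D, ContainsPivot z C (Set.range (f₁ 9)) x ↔
      ContainsPivot z C (Set.range (f₁ 9)) y) → ∀ u v, pattern z f₃ u ∈ pattern z f₃ '' D →
      pattern z f₃ v ∈ pattern z f₃ '' D → Share (z u) (z v) := by
    rintro D hD hiff u v ⟨x, hx, hu⟩ ⟨y, hy, hv⟩
    exact share_of_extremal_chain hz hC hf₁ hf₂ hf₃ (hD hx) (hD hy) (hiff x hx y hy)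
      (pattern_eq_iff.1 hu.symm) (pattern_eq_iff.1 hv.symm)
  refine ⟨f₃, pattern z f₃ '' {x ∈ C | ContainsPivot z C (Set.range (f₁ 9)) x},
    pattern z f₃ '' {x ∈ C | ¬ ContainsPivot z C (Set.range (f₁ 9)) x}, fun x hx => ?_,
    share _ (Set.sep_subset _ _) fun x hx y hy => iff_of_true hx.2 hy.2,
    share _ (Set.sep_subset _ _) fun x hx y hy => iff_of_false hx.2 hy.2⟩
  by_cases h : ContainsPivot z C (Set.range (f₁ 9)) x
  · exact Or.inl ⟨x, ⟨hx, h⟩, rfl⟩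
  · exact Or.inr ⟨x, ⟨hx, h⟩, rfl⟩

end Cover

/-! ### Paths of the grid as polygons -/

section Grid

variable {p q r c t : ℤ × ℤ} {o o' : Bool} {e : Sym2 (ℤ × ℤ)} {B : List (ℤ × ℤ)}

/-- The column (`o = false`) or the row (`o = true`) of a grid point. -/
def gridCoord (p : ℤ × ℤ) (o : Bool) : ℤ := if o then p.2 else p.1

/-- The grid point with coordinate `x` along the direction `o` and coordinate `a` across it. -/
def gridPoint (o : Bool) (x a : ℤ) : ℤ × ℤ := if o then (a, x) else (x, a)

/-- The grid edge along `o` from `x` to `x + 1`, on the line at `a`. -/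
def gridEdge (o : Bool) (x a : ℤ) : Sym2 (ℤ × ℤ) := s(gridPoint o x a, gridPoint o (x + 1) a)

theorem gridEdge_injective {x a x' a' : ℤ} (h : gridEdge o x a = gridEdge o' x' a') :
    o = o' ∧ x = x' ∧ a = a' := by
  cases o <;> cases o' <;> simp [gridEdge, gridPoint, Prod.ext_iff] at h ⊢ <;> omega

theorem gridPoint_gridCoord (o : Bool) (p : ℤ × ℤ) :
    gridPoint o (gridCoord p o) (gridCoord p (!o)) = p := by
  cases o <;> simp [gridPoint, gridCoord]

theorem gridCoord_ext (o : Bool) (h : gridCoord p o = gridCoord q o)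
    (h' : gridCoord p (!o) = gridCoord q (!o)) : p = q := by
  rw [← gridPoint_gridCoord o p, ← gridPoint_gridCoord o q, h, h']

/-- The points are neighbours in the grid, on a common line along `o`. -/
def AdjAlong (o : Bool) (p q : ℤ × ℤ) : Prop :=
  gridCoord p (!o) = gridCoord q (!o) ∧
    (gridCoord q o = gridCoord p o + 1 ∨ gridCoord q o + 1 = gridCoord p o)

theorem gridGraph_adj_iff : gridGraph.Adj p q ↔ ∃ o, AdjAlong o p q := by
  simp only [gridGraph, Bool.exists_bool, AdjAlong, gridCoord, Bool.not_false, Bool.not_true,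
    if_true, Bool.false_eq_true, if_false, abs_eq zero_le_one]
  omega

theorem AdjAlong.ne (h : AdjAlong o p q) : p ≠ q := by
  rintro rfl
  have := h.2
  omega

theorem AdjAlong.collinear_iff (hpq : AdjAlong o p q) (hqr : AdjAlong o' q r) :
    (p.1 = q.1 ∧ q.1 = r.1) ∨ (p.2 = q.2 ∧ q.2 = r.2) ↔ o' = o := by
  obtain ⟨h₁, h₂⟩ := hpq
  obtain ⟨h₃, h₄⟩ := hqr
  cases o <;> cases o' <;> simp [gridCoord] at h₁ h₂ h₃ h₄ ⊢ <;> omega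

/-- The edge is on the axis-parallel segment from `p` to `q`. -/
def OnSegment (p q : ℤ × ℤ) (e : Sym2 (ℤ × ℤ)) : Prop :=
  ∃ o x, gridCoord p (!o) = gridCoord q (!o) ∧
    (min (gridCoord p o) (gridCoord q o) ≤ x ∧ x < max (gridCoord p o) (gridCoord q o)) ∧
    e = gridEdge o x (gridCoord p (!o))

theorem onSegment_iff (h : gridCoord p (!o) = gridCoord q (!o)) : OnSegment p q e ↔
    ∃ x, (min (gridCoord p o) (gridCoord q o) ≤ x ∧ x < max (gridCoord p o) (gridCoord q o)) ∧
      e = gridEdge o x (gridCoord p (!o)) := by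
  refine ⟨?_, fun ⟨x, hx⟩ => ⟨o, x, h, hx⟩⟩
  rintro ⟨o', x, -, hx, he⟩
  rcases Bool.eq_or_eq_not o' o with rfl | rfl
  · exact ⟨x, hx, he⟩
  · omega

theorem onSegment_gridEdge {x a : ℤ} : OnSegment p q (gridEdge o x a) ↔
    gridCoord p (!o) = gridCoord q (!o) ∧ gridCoord p (!o) = a ∧
      min (gridCoord p o) (gridCoord q o) ≤ x ∧ x < max (gridCoord p o) (gridCoord q o) := by
  constructor
  · rintro ⟨o', x', h, hx, he⟩
    obtain ⟨rfl, rfl, rfl⟩ := gridEdge_injective he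
    exact ⟨h, rfl, hx⟩
  · rintro ⟨h, rfl, hx⟩
    exact ⟨o, x, h, hx, rfl⟩

theorem AdjAlong.exists_eq_gridEdge (h : AdjAlong o p q) :
    s(p, q) = gridEdge o (min (gridCoord p o) (gridCoord q o)) (gridCoord p (!o)) := by
  obtain ⟨h, hq | hp⟩ := h
  · rw [min_eq_left (by omega), gridEdge, ← hq, gridPoint_gridCoord, h, gridPoint_gridCoord]
  · rw [min_eq_right (by omega), gridEdge, hp, gridPoint_gridCoord, h, gridPoint_gridCoord,
      Sym2.eq_swap]

theorem AdjAlong.onSegment_iff (h : AdjAlong o p q) : OnSegment p q e ↔ e = s(p, q) := by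
  rw [_root_.onSegment_iff h.1, h.exists_eq_gridEdge]
  have := h.2
  constructor
  · rintro ⟨x, hx, rfl⟩
    congr 1
    omega
  · exact fun he => ⟨_, by omega, he⟩

/-- The unit step from `p` to `q` is along `o` and in the direction of `c`. -/
def StepTowards (o : Bool) (p q c : ℤ × ℤ) : Prop :=
  gridCoord p (!o) = gridCoord q (!o) ∧ gridCoord p (!o) = gridCoord c (!o) ∧
    ((gridCoord q o = gridCoord p o + 1 ∧ gridCoord p o < gridCoord c o) ∨
      (gridCoord q o + 1 = gridCoord p o ∧ gridCoord c o < gridCoord p o))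

theorem StepTowards.adjAlong (h : StepTowards o p q c) : AdjAlong o p q := by
  obtain ⟨h, -, h'⟩ := h
  exact ⟨h, by omega⟩

theorem AdjAlong.stepTowards (h : AdjAlong o p q) : StepTowards o p q q := by
  obtain ⟨h, h'⟩ := h
  exact ⟨h, h, by omega⟩

theorem StepTowards.ne (h : StepTowards o p q c) : p ≠ c := by
  rintro rfl
  obtain ⟨-, -, h⟩ := h
  omega

theorem StepTowards.onSegment_iff (h : StepTowards o p q c) :
    OnSegment p c e ↔ e = s(p, q) ∨ OnSegment q c e := by
  obtain ⟨hpq, hpc, hstep⟩ := id h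
  rw [← h.adjAlong.onSegment_iff, _root_.onSegment_iff hpc, _root_.onSegment_iff hpq,
    _root_.onSegment_iff (hpq.symm.trans hpc), ← exists_or, ← hpq]
  refine exists_congr fun x => ?_
  rw [← or_and_right]
  exact and_congr_left fun _ => by omega

theorem StepTowards.of_adjAlong (h : StepTowards o q r c) (hpq : AdjAlong o p q) (hpr : p ≠ r) :
    StepTowards o p q c := by
  obtain ⟨hqr, hqc, hstep⟩ := h
  obtain ⟨hpq, hstep'⟩ := hpq
  have hne : gridCoord p o ≠ gridCoord r o := fun he => hpr (gridCoord_ext o he (hpq.trans hqr))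
  exact ⟨hpq, hpq.trans hqc, by omega⟩

/-- The polygon with the corners `p`, those in the list, and `t` has nondegenerate segments that are
alternately along and across `o`. -/
def Alternating : Bool → ℤ × ℤ → List (ℤ × ℤ) → ℤ × ℤ → Prop
  | o, p, [], t => p ≠ t ∧ gridCoord p (!o) = gridCoord t (!o)
  | o, p, b :: B, t => p ≠ b ∧ gridCoord p (!o) = gridCoord b (!o) ∧ Alternating (!o) b B t

/-- The edge is on the polygon with the corners `p`, those in the list, and `t`. -/
def OnPolygon (e : Sym2 (ℤ × ℤ)) : ℤ × ℤ → List (ℤ × ℤ) → ℤ × ℤ → Prop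
  | p, [], t => OnSegment p t e
  | p, b :: B, t => OnSegment p b e ∨ OnPolygon e b B t

/-- The edges `E` of a path from `p` to `t` whose second point is `q` are those of the polygon
with the corners `p`, those in the list `B`, and `t`. -/
structure Traces (o : Bool) (p q : ℤ × ℤ) (B : List (ℤ × ℤ)) (t : ℤ × ℤ)
    (E : List (Sym2 (ℤ × ℤ))) : Prop where
  alternating : Alternating o p B t
  stepTowards : StepTowards o p q (B.headD t)
  mem_iff : ∀ e, e ∈ E ↔ OnPolygon e p B t

variable {E : List (Sym2 (ℤ × ℤ))}

theorem AdjAlong.traces (h : AdjAlong o p q) : Traces o p q [] q [s(p, q)] where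
  alternating := ⟨h.ne, h.1⟩
  stepTowards := h.stepTowards
  mem_iff e := by rw [List.mem_singleton, OnPolygon, h.onSegment_iff]

theorem Traces.extend (h : Traces o q r B t E) (hpq : AdjAlong o p q) (hpr : p ≠ r) :
    Traces o p q B t (s(p, q) :: E) := by
  have step := h.stepTowards.of_adjAlong hpq hpr
  refine ⟨?_, step, fun e => ?_⟩
  · cases B with
    | nil => exact ⟨step.ne, step.2.1⟩
    | cons b B => exact ⟨step.ne, step.2.1, h.alternating.2.2⟩
  · rw [List.mem_cons, h.mem_iff]
    cases B with
    | nil => exact step.onSegment_iff.symm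
    | cons b B => exact (or_assoc.symm.trans (or_congr_left step.onSegment_iff.symm))

theorem Traces.turn (h : Traces (!o) q r B t E) (hpq : AdjAlong o p q) :
    Traces o p q (q :: B) t (s(p, q) :: E) where
  alternating := ⟨hpq.ne, hpq.1, h.alternating⟩
  stepTowards := hpq.stepTowards
  mem_iff e := by rw [List.mem_cons, h.mem_iff, OnPolygon, hpq.onSegment_iff]

theorem exists_traces (w : gridGraph.Walk p t) (hw : w.IsPath) {l : List (ℤ × ℤ)}
    (hl : w.support = p :: q :: l) : ∃ o, Traces o p q (bendPoints w.support) t w.edges := by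
  induction w generalizing q l with
  | nil => simp at hl
  | @cons p q' t hadj w ih =>
    obtain ⟨o, hpq⟩ := gridGraph_adj_iff.1 hadj
    rw [SimpleGraph.Walk.cons_isPath_iff] at hw
    replace hl : w.support = q :: l := by simpa using hl
    obtain rfl : q' = q := (List.cons.inj (w.cons_tail_support.trans hl)).1
    rw [SimpleGraph.Walk.support_cons, SimpleGraph.Walk.edges_cons, hl]
    cases w with
    | nil =>
      obtain rfl : [] = l := by simpa using hl
      exact ⟨o, hpq.traces⟩
    | @cons _ r _ hadj' w =>
      obtain ⟨l', rfl⟩ : ∃ l', r :: l' = l :=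
        ⟨_, w.cons_tail_support.trans (by simpa using hl)⟩
      obtain ⟨o', h⟩ := ih hw.1 hl
      rw [hl] at h hw
      have hpr : p ≠ r := by rintro rfl; simp at hw
      simp only [bendPoints, hpq.collinear_iff h.stepTowards.adjAlong]
      split_ifs with ho
      · exact ⟨o, (ho ▸ h).extend hpq hpr⟩
      · exact ⟨o, ((Bool.eq_or_eq_not o' o).resolve_left ho ▸ h).turn hpq⟩

end Grid

section Representation

open Corners

variable {p t : ℤ × ℤ} {B : List (ℤ × ℤ)} {o : Bool} {x a : ℤ}

/-- The edge along `o` from `x` to `x + 1`, on the line at `a`, is on the path. -/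
def Corners.Covers (p : Corners) (o : Bool) (x a : ℤ) : Prop :=
  ∃ l r, HasSeg p o a l r ∧ l ≤ x ∧ x < r

theorem Corners.share_iff_exists_covers {p q : Corners} :
    Share p q ↔ ∃ o x a, Covers p o x a ∧ Covers q o x a := by
  constructor
  · rintro ⟨o, a, l, r, L, R, hp, hq, h, h'⟩
    have := hp.lt
    have := hq.lt
    exact ⟨o, max l L, a, ⟨l, r, hp, by omega, by omega⟩, ⟨L, R, hq, by omega, by omega⟩⟩
  · rintro ⟨o, x, a, ⟨l, r, hp, h₁, h₂⟩, ⟨L, R, hq, h₃, h₄⟩⟩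
    exact ⟨o, a, l, r, L, R, hp, hq, by omega, by omega⟩

theorem Corners.covers_iff {p : Corners} : Covers p o x a ↔
    ∃ i : Fin 3, p i.castSucc (!o) = p i.succ (!o) ∧ p i.castSucc (!o) = a ∧
      min (p i.castSucc o) (p i.succ o) ≤ x ∧ x < max (p i.castSucc o) (p i.succ o) := by
  constructor
  · rintro ⟨_, _, ⟨i, j, ⟨hij | hij, h, -⟩, rfl, rfl, rfl⟩, hx⟩
    · obtain ⟨k, rfl, rfl⟩ : ∃ k : Fin 3, k.castSucc = i ∧ k.succ = j :=
        ⟨⟨i, by omega⟩, rfl, Fin.ext hij⟩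
      exact ⟨k, h, rfl, by omega, by omega⟩
    · obtain ⟨k, rfl, rfl⟩ : ∃ k : Fin 3, k.succ = i ∧ k.castSucc = j :=
        ⟨⟨j, by omega⟩, Fin.ext hij, rfl⟩
      exact ⟨k, h.symm, h.symm, by omega, by omega⟩
  · rintro ⟨i, h, rfl, hx⟩
    rcases le_or_gt (p i.castSucc o) (p i.succ o) with hle | hlt
    · exact ⟨_, _, ⟨i.castSucc, i.succ, ⟨Or.inl (by simp), h, by omega⟩, rfl, rfl, rfl⟩, by omega⟩
    · exact ⟨_, _, ⟨i.succ, i.castSucc, ⟨Or.inr (by simp), h.symm, hlt⟩, h.symm, rfl, rfl⟩,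
        by omega⟩

/-- The corners of a polygon with at most two bends, padded with the last one. -/
def polygonCorners (p : ℤ × ℤ) (B : List (ℤ × ℤ)) (t : ℤ × ℤ) : Corners :=
  fun j o => gridCoord ((p :: B).getD j t) o

theorem Alternating.valid_polygonCorners (h : Alternating o p B t) (hB : B.length ≤ 2) :
    Valid (polygonCorners p B t) := by
  refine ⟨o, ?_⟩
  match B, hB, h with
  | [], _, h => exact ⟨h.2, rfl, rfl, fun _ => rfl⟩
  | [b], _, ⟨_, hpb, _, hbt⟩ => exact ⟨hpb, (Bool.not_not o ▸ hbt :), rfl, fun _ => rfl⟩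
  | [b, c], _, ⟨_, hpb, hne, hbc, _, hct⟩ =>
    rw [Bool.not_not] at hbc hct
    exact ⟨hpb, hbc, hct, fun h => absurd (gridCoord_ext o hbc h) hne⟩

theorem onPolygon_gridEdge (hB : B.length ≤ 2) :
    OnPolygon (gridEdge o x a) p B t ↔ Covers (polygonCorners p B t) o x a := by
  simp only [covers_iff, Fin.exists_fin_succ, polygonCorners]
  match B, hB with
  | [], _ | [b, c], _ => simp [OnPolygon, onSegment_gridEdge]
  | [b], _ =>
    simp [OnPolygon, onSegment_gridEdge]; grind

theorem valid_polygonCorners_bendPoints (w : gridGraph.Walk p t) (hw : w.IsPath)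
    (h : (bendPoints w.support).length ≤ 2) :
    Valid (polygonCorners p (bendPoints w.support) t) := by
  cases w with
  | nil => exact ⟨true, rfl, rfl, rfl, fun _ => rfl⟩
  | cons hadj w =>
    obtain ⟨o, hT⟩ := exists_traces _ hw (congr_arg _ w.cons_tail_support.symm)
    exact hT.alternating.valid_polygonCorners h

theorem mem_edges_iff_onPolygon (w : gridGraph.Walk p t) (hw : w.IsPath) {e : Sym2 (ℤ × ℤ)} :
    e ∈ w.edges ↔ OnPolygon e p (bendPoints w.support) t := by
  cases w with
  | nil =>
    simp only [SimpleGraph.Walk.edges_nil, List.not_mem_nil, SimpleGraph.Walk.support_nil,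
      bendPoints, OnPolygon, onSegment_iff (o := true) rfl, false_iff]
    rintro ⟨x, hx, -⟩
    omega
  | cons hadj w =>
    obtain ⟨o, hT⟩ := exists_traces _ hw (congr_arg _ w.cons_tail_support.symm)
    exact hT.mem_iff e

theorem exists_eq_gridEdge (w : gridGraph.Walk p t) {e : Sym2 (ℤ × ℤ)} (he : e ∈ w.edges) :
    ∃ o x a, e = gridEdge o x a := by
  induction e with
  | _ p q =>
    obtain ⟨o, h⟩ := gridGraph_adj_iff.1 (w.adj_of_mem_edges he)
    exact ⟨o, _, _, h.exists_eq_gridEdge⟩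

variable {V : Type*} {G : SimpleGraph V} (R : EPGRep 2 G)

/-- The four corners of the path of a vertex. -/
def EPGRep.corners (v : V) : Corners := fun j o => gridCoord (R.corner v j) o

theorem EPGRep.valid_corners (v : V) : Valid (R.corners v) :=
  valid_polygonCorners_bendPoints _ (R.path v).2 (R.bends_le v)

theorem EPGRep.gridEdge_mem_edges_iff {v : V} :
    gridEdge o x a ∈ (R.path v).1.edges ↔ Covers (R.corners v) o x a :=
  (mem_edges_iff_onPolygon _ (R.path v).2).trans (onPolygon_gridEdge (R.bends_le v))

theorem EPGRep.adj_iff_share {u v : V} :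
    G.Adj u v ↔ u ≠ v ∧ Share (R.corners u) (R.corners v) := by
  simp only [R.adj_iff, share_iff_exists_covers, ← R.gridEdge_mem_edges_iff]
  refine and_congr_right fun _ => ⟨fun ⟨e, hu, hv⟩ => ?_, fun ⟨o, x, a, h⟩ => ⟨_, h⟩⟩
  obtain ⟨o, x, a, rfl⟩ := exists_eq_gridEdge _ hu
  exact ⟨o, x, a, hu, hv⟩

end Representation

/-! ### Polynomial-time computations on random access machines -/

namespace RAM

open Finset

/-- The contents of the arrays. -/
abbrev Mem := ℕ → ℤ → ℤ

/-- The values that a program finds in registers, as functions of some environment: a size, in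
which its running time is measured, and further variables. -/
structure Ctx (Γ : Type) where
  size : Γ → ℕ
  vars : List (Γ → ℤ)

/-- The context with one further variable. -/
def Ctx.cons {Γ β : Type} (val : β → ℤ) (c : Ctx Γ) : Ctx (Γ × β) where
  size γ := c.size γ.1
  vars := (fun γ => val γ.2) :: c.vars.map fun v γ => v γ.1

/-- The context with one further variable, a natural number. -/
abbrev Ctx.ext {Γ : Type} (c : Ctx Γ) : Ctx (Γ × ℕ) := c.cons Nat.cast

/-- The context with `m` further variables, natural numbers. -/
def Ctx.extTuple {Γ : Type} (c : Ctx Γ) (m : ℕ) : Ctx (Γ × (Fin m → ℕ)) where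
  size γ := c.size γ.1
  vars := (List.finRange m).map (fun j γ => (γ.2 j : ℤ)) ++ c.vars.map fun v γ => v γ.1

variable {Γ : Type} {c : Ctx Γ} {ν : ℕ → ℕ} {e : ℕ} {γ : Γ} {s s' : State}

/-- Register 0 holds the size, and the registers `ν i` hold the variables. -/
def Ctx.Holds (c : Ctx Γ) (ν : ℕ → ℕ) (γ : Γ) (s : State) : Prop :=
  s.reg 0 = c.size γ ∧ ∀ i v, c.vars[i]? = some v → s.reg (ν i) = v γ

/-- The registers `ν i` that hold the variables, and register 0, are below `e`. -/
def Ctx.Below (c : Ctx Γ) (ν : ℕ → ℕ) (e : ℕ) : Prop :=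
  0 < e ∧ ∀ i < c.vars.length, ν i < e

theorem Ctx.Holds.of_eq (h : c.Holds ν γ s) (hν : c.Below ν e) (hs : ∀ r < e, s'.reg r = s.reg r) :
    c.Holds ν γ s' :=
  ⟨(hs 0 hν.1).trans h.1, fun i v hv =>
    (hs _ (hν.2 i (List.getElem?_eq_some_iff.1 hv).1)).trans (h.2 i v hv)⟩

theorem Ctx.exists_reg {v : Γ → ℤ} (hv : v ∈ c.vars) :
    ∃ i, ∀ ν γ s, c.Holds ν γ s → s.reg (ν i) = v γ := by
  obtain ⟨i, hi⟩ := List.mem_iff_getElem?.1 hv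
  exact ⟨i, fun ν γ s h => h.2 i v hi⟩

theorem Ctx.snd_mem {β : Type} {val : β → ℤ} : (fun γ => val γ.2) ∈ (c.cons val).vars :=
  List.mem_cons_self ..

theorem Ctx.fst_mem {β : Type} {val : β → ℤ} {v : Γ → ℤ} (hv : v ∈ c.vars) :
    (fun γ => v γ.1) ∈ (c.cons val).vars :=
  List.mem_cons_of_mem _ (List.mem_map.2 ⟨v, hv, rfl⟩)

/-- The assignment of registers to variables with register `e` for a new first variable. -/
def extReg (ν : ℕ → ℕ) (e : ℕ) : ℕ → ℕ
  | 0 => e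
  | i + 1 => ν i

variable {β : Type} {val : β → ℤ}

theorem Ctx.Holds.cons (h : c.Holds ν γ s) {b : β} (hb : s.reg e = val b) :
    (c.cons val).Holds (extReg ν e) (γ, b) s := by
  refine ⟨h.1, ?_⟩
  rintro (_ | i) v hv
  · rw [Ctx.cons, List.getElem?_cons_zero, Option.some_inj] at hv
    exact hv ▸ hb
  · rw [Ctx.cons, List.getElem?_cons_succ, List.getElem?_map, Option.map_eq_some_iff] at hv
    obtain ⟨w, hw, rfl⟩ := hv
    exact h.2 i w hw

theorem Ctx.Below.cons {e' : ℕ} (h : c.Below ν e) (hee' : e ≤ e') :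
    (c.cons val).Below (extReg ν e') (e' + 1) := by
  refine ⟨e'.succ_pos, ?_⟩
  rintro (_ | i) hi
  · exact e'.lt_succ_self
  · exact (h.2 i (by simpa [Ctx.cons] using hi)).trans_le (hee'.trans e'.le_succ)

/-- The variables of `c` at `g γ` are among those of `c'` at `γ`. -/
structure Ctx.Hom {Γ' : Type} (c' : Ctx Γ') (c : Ctx Γ) (g : Γ' → Γ) : Prop where
  size_eq : ∀ γ, c.size (g γ) = c'.size γ
  comp_mem : ∀ v ∈ c.vars, v ∘ g ∈ c'.vars

theorem Ctx.Hom.fst : (c.cons val).Hom c Prod.fst where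
  size_eq _ := rfl
  comp_mem _ := Ctx.fst_mem

theorem Ctx.Hom.cons {Γ' : Type} {c' : Ctx Γ'} {g : Γ' → Γ} (h : c'.Hom c g) {f : Γ' → β}
    (hf : (fun γ => val (f γ)) ∈ c'.vars) : c'.Hom (c.cons val) fun γ => (g γ, f γ) where
  size_eq := h.size_eq
  comp_mem v hv := by
    rcases List.mem_cons.1 hv with rfl | hv
    · exact hf
    · obtain ⟨w, hw, rfl⟩ := List.mem_map.1 hv
      exact h.comp_mem w hw

theorem Ctx.Hom.extTuple_zero : c.Hom (c.extTuple 0) fun γ => (γ, Fin.elim0) where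
  size_eq _ := rfl
  comp_mem v hv := by
    obtain ⟨w, hw, rfl⟩ : ∃ w ∈ c.vars, (fun γ => w γ.1) = v := by simpa [Ctx.extTuple] using hv
    exact hw

theorem Ctx.Hom.extTuple_succ {m : ℕ} :
    (c.ext.extTuple m).Hom (c.extTuple (m + 1)) fun γ => (γ.1.1, Fin.cons γ.1.2 γ.2) where
  size_eq _ := rfl
  comp_mem v hv := by
    simp only [Ctx.extTuple, Ctx.cons, List.mem_append, List.mem_map, List.mem_finRange, true_and,
      List.mem_cons] at hv ⊢
    rcases hv with ⟨j, rfl⟩ | ⟨w, hw, rfl⟩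
    · cases j using Fin.cases with
      | zero => exact Or.inr ⟨_, Or.inl rfl, rfl⟩
      | succ j => exact Or.inl ⟨j, rfl⟩
    · exact Or.inr ⟨_, Or.inr ⟨w, hw, rfl⟩, rfl⟩

/-- The function `F`, which gives new contents of the arrays and a result, is computable in
polynomial time: for every assignment of registers to the variables, and every `e` above them, some
program leaves the result in register `e` and does not change the registers below `e`. -/
def PolyTime (c : Ctx Γ) (F : Γ → Mem → Mem × ℤ) : Prop :=
  ∀ ν e, c.Below ν e → ∃ (P : Prog) (q : Polynomial ℕ), ∀ γ s, c.Holds ν γ s →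
    ∃ t s', Exec P s t s' ∧ t ≤ q.eval (c.size γ) ∧ (∀ r < e, s'.reg r = s.reg r) ∧
      s'.arr = (F γ s.arr).1 ∧ s'.reg e = (F γ s.arr).2

/-- The value `τ` is computable in polynomial time. -/
def Computes (c : Ctx Γ) (τ : Γ → Mem → ℤ) : Prop := PolyTime c fun γ A => (A, τ γ A)

/-- The transformation `F` of the arrays is computable in polynomial time. -/
def Transforms (c : Ctx Γ) (F : Γ → Mem → Mem) : Prop := PolyTime c fun γ A => (F γ A, 0)

open Classical in
/-- The predicate `φ` is decidable in polynomial time. -/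
def Decides (c : Ctx Γ) (φ : Γ → Mem → Prop) : Prop :=
  Computes c fun γ A => if φ γ A then 1 else 0

variable {F G : Γ → Mem → Mem × ℤ} {τ σ : Γ → Mem → ℤ} {φ ψ : Γ → Mem → Prop}

theorem PolyTime.of_instr (h : ∀ ν e, c.Below ν e → ∃ I : Instr, ∀ γ s, c.Holds ν γ s →
    (∀ r < e, (I.apply s).reg r = s.reg r) ∧ (I.apply s).arr = (F γ s.arr).1 ∧
      (I.apply s).reg e = (F γ s.arr).2) : PolyTime c F := by
  intro ν e hν
  obtain ⟨I, hI⟩ := h ν e hν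
  exact ⟨.instr I, 1, fun γ s hs => ⟨1, _, .instr I s, by simp, hI γ s hs⟩⟩

theorem Computes.const (z : ℤ) : Computes c fun _ _ => z :=
  PolyTime.of_instr fun _ e _ =>
    ⟨.const e z, fun _ _ _ =>
      ⟨fun r hr => by simp [Instr.apply, hr.ne], rfl, by simp [Instr.apply]⟩⟩

theorem Computes.size : Computes c fun γ _ => (c.size γ : ℤ) :=
  PolyTime.of_instr fun _ e _ => ⟨.copy e 0, fun _ _ hs =>
    ⟨fun r hr => by simp [Instr.apply, hr.ne], rfl, by simp [Instr.apply, hs.1]⟩⟩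

theorem Computes.var {v : Γ → ℤ} (hv : v ∈ c.vars) : Computes c fun γ _ => v γ := by
  obtain ⟨i, hi⟩ := Ctx.exists_reg hv
  exact PolyTime.of_instr fun ν e _ => ⟨.copy e (ν i), fun γ s hs =>
    ⟨fun r hr => by simp [Instr.apply, hr.ne], rfl, by simp [Instr.apply, hi ν γ s hs]⟩⟩

theorem Computes.last : Computes (c.cons val) fun γ _ => val γ.2 :=
  .var Ctx.snd_mem

theorem PolyTime.comap {Γ' : Type} {c' : Ctx Γ'} {g : Γ' → Γ} (h : PolyTime c F)
    (hg : c'.Hom c g) : PolyTime c' fun γ A => F (g γ) A := by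
  intro ν e hν
  have hreg : ∀ i : ℕ, ∃ j : ℕ, ∀ v, c.vars[i]? = some v → c'.vars[j]? = some (v ∘ g) := by
    intro i
    rcases hi : c.vars[i]? with _ | v
    · exact ⟨0, by simp⟩
    · obtain ⟨j, hj⟩ := List.mem_iff_getElem?.1 (hg.comp_mem v (List.mem_of_getElem? hi))
      exact ⟨j, by simpa using hj⟩
  choose f hf using hreg
  obtain ⟨P, q, hP⟩ := h (ν ∘ f) e ⟨hν.1, fun i hi =>
    hν.2 _ (List.getElem?_eq_some_iff.1 (hf i _ (List.getElem?_eq_getElem hi))).1⟩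
  refine ⟨P, q, fun γ s hs => ?_⟩
  rw [← hg.size_eq]
  exact hP (g γ) s ⟨(hg.size_eq γ).symm ▸ hs.1, fun i v hi => hs.2 _ _ (hf i v hi)⟩

theorem PolyTime.bind {G : Γ × ℤ → Mem → Mem × ℤ} (hF : PolyTime c F)
    (hG : PolyTime (c.cons id) G) :
    PolyTime c fun γ A => G (γ, (F γ A).2) (F γ A).1 := by
  intro ν e hν
  obtain ⟨P, p, hP⟩ := hF ν e hν
  obtain ⟨Q, q, hQ⟩ := hG (extReg ν e) (e + 1) (hν.cons le_rfl)
  refine ⟨.seq P (.seq Q (.instr (.copy e (e + 1)))), p + (q + 1), fun γ s hs => ?_⟩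
  obtain ⟨t₁, s₁, x₁, l₁, r₁, a₁, v₁⟩ := hP γ s hs
  obtain ⟨t₂, s₂, x₂, l₂, r₂, a₂, v₂⟩ := hQ (γ, (F γ s.arr).2) s₁ ((hs.of_eq hν r₁).cons v₁)
  rw [a₁] at a₂ v₂
  refine ⟨_, _, x₁.seq (x₂.seq (.instr _ _)), ?_, fun r hr => ?_, a₂, ?_⟩
  · simp only [Polynomial.eval_add, Polynomial.eval_one]
    exact add_le_add l₁ (add_le_add_left l₂ 1)
  · simp [Instr.apply, hr.ne, r₂ r (by omega), r₁ r hr]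
  · simp [Instr.apply, v₂]

theorem PolyTime.bind₂ {H : ℤ → ℤ → Γ → Mem → Mem × ℤ} (hτ : Computes c τ) (hσ : Computes c σ)
    (hH : PolyTime ((c.cons id).cons id) fun γ A => H γ.1.2 γ.2 γ.1.1 A) :
    PolyTime c fun γ A => H (τ γ A) (σ γ A) γ A :=
  PolyTime.bind hτ (PolyTime.bind (PolyTime.comap hσ .fst) hH)

section Instructions

variable {v w : Γ → ℤ}

theorem Computes.add_var (hv : v ∈ c.vars) (hw : w ∈ c.vars) : Computes c fun γ _ => v γ + w γ := by
  obtain ⟨i, hi⟩ := Ctx.exists_reg hv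
  obtain ⟨j, hj⟩ := Ctx.exists_reg hw
  exact PolyTime.of_instr fun ν e _ => ⟨.add e (ν i) (ν j), fun γ s hs =>
    ⟨fun r hr => by simp [Instr.apply, hr.ne], rfl,
      by simp [Instr.apply, hi ν γ s hs, hj ν γ s hs]⟩⟩

theorem Computes.load_var (a : ℕ) (hv : v ∈ c.vars) : Computes c fun γ A => A a (v γ) := by
  obtain ⟨i, hi⟩ := Ctx.exists_reg hv
  exact PolyTime.of_instr fun ν e _ => ⟨.load e a (ν i), fun γ s hs =>
    ⟨fun r hr => by simp [Instr.apply, hr.ne], rfl, by simp [Instr.apply, hi ν γ s hs]⟩⟩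

theorem PolyTime.branch_var (hv : v ∈ c.vars) (hw : w ∈ c.vars) (hF : PolyTime c F)
    (hG : PolyTime c G) : PolyTime c fun γ A => if v γ < w γ then F γ A else G γ A := by
  intro ν e hν
  obtain ⟨i, hi⟩ := Ctx.exists_reg hv
  obtain ⟨j, hj⟩ := Ctx.exists_reg hw
  obtain ⟨P, p, hP⟩ := hF ν e hν
  obtain ⟨Q, q, hQ⟩ := hG ν e hν
  refine ⟨.branch (ν i) (ν j) P Q, p + q + 1, fun γ s hs => ?_⟩
  simp only [Polynomial.eval_add, Polynomial.eval_one]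
  rw [← hi ν γ s hs, ← hj ν γ s hs]
  split_ifs with h
  · obtain ⟨t, s', x, l, h'⟩ := hP γ s hs
    exact ⟨t + 1, s', .branch_true h x, by omega, h'⟩
  · obtain ⟨t, s', x, l, h'⟩ := hQ γ s hs
    exact ⟨t + 1, s', .branch_false h x, by omega, h'⟩

theorem Transforms.store_var (a : ℕ) (hv : v ∈ c.vars) (hw : w ∈ c.vars) :
    Transforms c fun γ A => Function.update A a (Function.update (A a) (v γ) (w γ)) := by
  intro ν e _
  obtain ⟨i, hi⟩ := Ctx.exists_reg hv
  obtain ⟨j, hj⟩ := Ctx.exists_reg hw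
  refine ⟨.seq (.instr (.store a (ν i) (ν j))) (.instr (.const e 0)), 2, fun γ s hs =>
    ⟨_, _, .seq (.instr _ _) (.instr _ _), by simp, fun r hr => ?_, ?_, ?_⟩⟩
  · simp [Instr.apply, hr.ne]
  · simp [Instr.apply, hi ν γ s hs, hj ν γ s hs]
  · simp [Instr.apply]

end Instructions

theorem Computes.add (hτ : Computes c τ) (hσ : Computes c σ) :
    Computes c fun γ A => τ γ A + σ γ A :=
  PolyTime.bind₂ (H := fun x y _ A => (A, x + y)) hτ hσ
    (Computes.add_var (Ctx.fst_mem Ctx.snd_mem) Ctx.snd_mem)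

theorem Computes.load (a : ℕ) (hτ : Computes c τ) : Computes c fun γ A => A a (τ γ A) :=
  PolyTime.bind (G := fun γ A => (A, A a γ.2)) hτ (Computes.load_var a Ctx.snd_mem)

theorem Transforms.store (a : ℕ) (hτ : Computes c τ) (hσ : Computes c σ) :
    Transforms c fun γ A => Function.update A a (Function.update (A a) (τ γ A) (σ γ A)) :=
  PolyTime.bind₂ (H := fun x y _ A => (Function.update A a (Function.update (A a) x y), 0)) hτ hσ
    (Transforms.store_var a (Ctx.fst_mem Ctx.snd_mem) Ctx.snd_mem)

theorem Transforms.id : Transforms c fun _ A => A := Computes.const 0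

theorem Transforms.comp {F G : Γ → Mem → Mem} (hF : Transforms c F) (hG : Transforms c G) :
    Transforms c fun γ A => G γ (F γ A) :=
  PolyTime.bind hF (PolyTime.comap hG .fst)

theorem PolyTime.branch (hτ : Computes c τ) (hσ : Computes c σ) (hF : PolyTime c F)
    (hG : PolyTime c G) : PolyTime c fun γ A => if τ γ A < σ γ A then F γ A else G γ A :=
  PolyTime.bind₂ (H := fun x y γ A => if x < y then F γ A else G γ A) hτ hσ
    (PolyTime.branch_var (Ctx.fst_mem Ctx.snd_mem) Ctx.snd_mem
      ((hF.comap .fst).comap .fst) ((hG.comap .fst).comap .fst))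

theorem PolyTime.congr (h : PolyTime c F) (e : ∀ γ A, F γ A = G γ A) : PolyTime c G := by
  rwa [show G = F from funext₂ fun γ A => (e γ A).symm]

theorem Computes.congr (h : Computes c τ) (e : ∀ γ A, τ γ A = σ γ A) : Computes c σ := by
  rwa [show σ = τ from funext₂ fun γ A => (e γ A).symm]

theorem Transforms.congr {F G : Γ → Mem → Mem} (h : Transforms c F) (e : ∀ γ A, F γ A = G γ A) :
    Transforms c G := by
  rwa [show G = F from funext₂ fun γ A => (e γ A).symm]

theorem Decides.congr (h : Decides c φ) (e : ∀ γ A, φ γ A ↔ ψ γ A) : Decides c ψ := by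
  rwa [show ψ = φ from funext₂ fun γ A => propext (e γ A).symm]

theorem Decides.lt (hτ : Computes c τ) (hσ : Computes c σ) :
    Decides c fun γ A => τ γ A < σ γ A := by
  unfold Decides Computes
  refine (PolyTime.branch hτ hσ (Computes.const 1) (Computes.const 0)).congr fun γ A => ?_
  by_cases h : τ γ A < σ γ A <;> simp only [h, if_true, if_false]

open Classical in
theorem PolyTime.ite (hφ : Decides c φ) (hF : PolyTime c F) (hG : PolyTime c G) :
    PolyTime c fun γ A => if φ γ A then F γ A else G γ A :=
  (PolyTime.branch (Computes.const 0) hφ hF hG).congr fun γ A => by split_ifs <;> simp_all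

open Classical in
theorem Computes.ite (hφ : Decides c φ) (hτ : Computes c τ) (hσ : Computes c σ) :
    Computes c fun γ A => if φ γ A then τ γ A else σ γ A :=
  (PolyTime.ite hφ hτ hσ).congr fun _ _ => (apply_ite ..).symm

open Classical in
theorem Transforms.ite {F G : Γ → Mem → Mem} (hφ : Decides c φ) (hF : Transforms c F)
    (hG : Transforms c G) : Transforms c fun γ A => if φ γ A then F γ A else G γ A :=
  (PolyTime.ite hφ hF hG).congr fun _ _ => (apply_ite (·, (0 : ℤ)) ..).symm

theorem Decides.and (h : Decides c φ) (h' : Decides c ψ) : Decides c fun γ A => φ γ A ∧ ψ γ A :=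
  (Computes.ite h h' (.const 0)).congr fun γ A => by by_cases φ γ A <;> by_cases ψ γ A <;> simp [*]

theorem Decides.not (h : Decides c φ) : Decides c fun γ A => ¬ φ γ A :=
  (Computes.ite h (.const 0) (.const 1)).congr fun γ A => by by_cases φ γ A <;> simp [*]

theorem Decides.or (h : Decides c φ) (h' : Decides c ψ) : Decides c fun γ A => φ γ A ∨ ψ γ A :=
  (h.not.and h'.not).not.congr fun _ _ => or_iff_not_and_not.symm

theorem Decides.imp (h : Decides c φ) (h' : Decides c ψ) : Decides c fun γ A => φ γ A → ψ γ A :=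
  (h.not.or h').congr fun _ _ => imp_iff_not_or.symm

theorem Decides.le (hτ : Computes c τ) (hσ : Computes c σ) : Decides c fun γ A => τ γ A ≤ σ γ A :=
  (Decides.lt hσ hτ).not.congr fun _ _ => not_lt

theorem Decides.eq (hτ : Computes c τ) (hσ : Computes c σ) : Decides c fun γ A => τ γ A = σ γ A :=
  ((Decides.le hτ hσ).and (Decides.le hσ hτ)).congr fun _ _ => le_antisymm_iff.symm

theorem Decides.const (p : Prop) : Decides c fun _ _ => p := Computes.const _

theorem Decides.exists_finite {ι : Type*} [Finite ι] {φ : ι → Γ → Mem → Prop}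
    (h : ∀ i, Decides c (φ i)) : Decides c fun γ A => ∃ i, φ i γ A := by
  classical
  cases nonempty_fintype ι
  suffices key : ∀ s : Finset ι, Decides c fun γ A => ∃ i ∈ s, φ i γ A from
    (key univ).congr fun γ A => by simp
  intro s
  induction s using Finset.induction_on with
  | empty => exact (Decides.const False).congr fun γ A => by simp
  | insert i s _ ih => exact ((h i).or ih).congr fun γ A => by simp

theorem Decides.forall_finite {ι : Type*} [Finite ι] {φ : ι → Γ → Mem → Prop}
    (h : ∀ i, Decides c (φ i)) : Decides c fun γ A => ∀ i, φ i γ A :=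
  (Decides.exists_finite fun i => (h i).not).not.congr fun _ _ => not_exists_not

theorem Exec.exists_loop {x y : ℕ} {P : Prog} (I : ℕ → State → Prop) (N B : ℕ)
    (hstep : ∀ i < N, ∀ s, I i s → s.reg x < s.reg y ∧ ∃ t s', Exec P s t s' ∧ t ≤ B ∧ I (i + 1) s')
    (hend : ∀ s, I N s → ¬ s.reg x < s.reg y) (hs : I 0 s) :
    ∃ t s', Exec (.loop x y P) s t s' ∧ t ≤ N * (B + 1) + 1 ∧ I N s' := by
  induction N generalizing I s with
  | zero => exact ⟨1, s, .loop_false (hend s hs), by simp, hs⟩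
  | succ N ih =>
    obtain ⟨hlt, t, s', hx, ht, hs'⟩ := hstep 0 N.succ_pos s hs
    obtain ⟨t', s'', hx', ht', hs''⟩ :=
      ih (fun i => I (i + 1)) (fun i hi => hstep (i + 1) (by omega)) hend hs'
    exact ⟨_, s'', .loop_true hlt hx hx', by rw [add_one_mul]; omega, hs''⟩

theorem PolyTime.exists_loop_body {F : Γ × ℕ → Mem → Mem × ℤ} (h : PolyTime c.ext F)
    (hν : c.Below ν e) : ∃ (P : Prog) (q : Polynomial ℕ), ∀ γ (i : ℕ) s, c.Holds ν γ s →
      s.reg (e + 2) = i → ∃ t s', Exec P s t s' ∧ t ≤ q.eval (c.size γ) ∧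
        (∀ r < e, s'.reg r = s.reg r) ∧ s'.arr = (F (γ, i) s.arr).1 ∧
        s'.reg e = s.reg e + (F (γ, i) s.arr).2 ∧ s'.reg (e + 1) = s.reg (e + 1) ∧
        s'.reg (e + 2) = i + 1 := by
  obtain ⟨P, q, hP⟩ := h (extReg ν (e + 2)) (e + 3) (hν.cons (by omega))
  refine ⟨.seq P (.seq (.instr (.add e e (e + 3))) (.seq (.instr (.const (e + 3) 1))
    (.instr (.add (e + 2) (e + 2) (e + 3))))), q + 3, fun γ i s hs hi => ?_⟩
  obtain ⟨t, s', x, l, r, a, v⟩ := hP (γ, i) s (hs.cons hi)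
  refine ⟨_, _, x.seq (.seq (.instr _ _) (.seq (.instr _ _) (.instr _ _))), ?_, fun j hj => ?_, ?_,
    ?_, ?_, ?_⟩
  · rw [Polynomial.eval_add, Polynomial.eval_ofNat]
    exact add_le_add_left l 3
  · simp [Instr.apply, hj.ne, (show j ≠ e + 2 by omega), (show j ≠ e + 3 by omega),
      r j (by omega)]
  · simp [Instr.apply, a]
  · simp [Instr.apply, r e (by omega), v]
  · simp [Instr.apply, r (e + 1) (by omega)]
  · simp [Instr.apply, r (e + 2) (by omega), hi]

theorem PolyTime.loop (k : ℕ) {F : Γ × ℕ → Mem → Mem × ℤ} (h : PolyTime c.ext F) :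
    PolyTime c fun γ A => (List.range (c.size γ + k)).foldl
      (fun B i => ((F (γ, i) B.1).1, B.2 + (F (γ, i) B.1).2)) (A, 0) := by
  intro ν e hν
  obtain ⟨P, q, hP⟩ := h.exists_loop_body hν
  refine ⟨.seq (.instr (.const e 0)) (.seq (.instr (.const (e + 1) k))
    (.seq (.instr (.add (e + 1) (e + 1) 0))
      (.seq (.instr (.const (e + 2) 0)) (.loop (e + 2) (e + 1) P)))),
    (Polynomial.X + Polynomial.C k) * (q + 1) + 5, fun γ s hs => ?_⟩
  let B (i : ℕ) := (List.range i).foldl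
    (fun B i => ((F (γ, i) B.1).1, B.2 + (F (γ, i) B.1).2)) (s.arr, (0 : ℤ))
  have hB (i : ℕ) : B (i + 1) = ((F (γ, i) (B i).1).1, (B i).2 + (F (γ, i) (B i).1).2) := by
    simp only [B, List.range_succ, List.foldl_append, List.foldl_cons, List.foldl_nil]
  let I (i : ℕ) (s' : State) : Prop := (∀ r < e, s'.reg r = s.reg r) ∧ s'.arr = (B i).1 ∧
    s'.reg e = (B i).2 ∧ s'.reg (e + 1) = c.size γ + k ∧ s'.reg (e + 2) = i
  have step : ∀ i < c.size γ + k, ∀ s₁, I i s₁ → s₁.reg (e + 2) < s₁.reg (e + 1) ∧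
      ∃ t s₂, Exec P s₁ t s₂ ∧ t ≤ q.eval (c.size γ) ∧ I (i + 1) s₂ := by
    rintro i hi s₁ ⟨h₁, h₂, h₃, h₄, h₅⟩
    refine ⟨by omega, ?_⟩
    obtain ⟨t, s₂, x, l, g₁, g₂, g₃, g₄, g₅⟩ := hP γ i s₁ (hs.of_eq hν h₁) h₅
    rw [h₂] at g₂ g₃
    rw [h₃] at g₃
    exact ⟨t, s₂, x, l, fun r hr => (g₁ r hr).trans (h₁ r hr), by rw [g₂, hB], by rw [g₃, hB],
      g₄.trans h₄, by rw [g₅, Nat.cast_succ]⟩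
  have init : I 0 ((Instr.const (e + 2) 0).apply <| (Instr.add (e + 1) (e + 1) 0).apply <|
      (Instr.const (e + 1) k).apply <| (Instr.const e 0).apply s) := by
    refine ⟨fun r hr => ?_, rfl, ?_, ?_, ?_⟩
    · simp [Instr.apply, hr.ne, (show r ≠ e + 1 by omega), (show r ≠ e + 2 by omega)]
    · simp [Instr.apply, B]
    · simp [Instr.apply, hν.1.ne, hs.1, add_comm]
    · simp [Instr.apply]
  obtain ⟨t, s', x, l, h₁, h₂, h₃, -⟩ :=
    Exec.exists_loop I _ _ step (fun _ ⟨_, _, _, hbound, hindex⟩ => by simp [hbound, hindex]) init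
  refine ⟨_, s', .seq (.instr _ _) (.seq (.instr _ _) (.seq (.instr _ _) (.seq (.instr _ _) x))),
    ?_, h₁, h₂, h₃⟩
  simp only [Polynomial.eval_add, Polynomial.eval_mul, Polynomial.eval_X, Polynomial.eval_ofNat,
    Polynomial.eval_C, Polynomial.eval_one]
  omega

theorem Computes.sum {τ : Γ × ℕ → Mem → ℤ} (h : Computes c.ext τ) :
    Computes c fun γ A => ∑ i ∈ range (c.size γ), τ (γ, i) A := by
  refine (PolyTime.loop 0 h).congr fun γ A => ?_
  dsimp only
  rw [add_zero]
  induction c.size γ with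
  | zero => rfl
  | succ n ih =>
    rw [List.range_succ, List.foldl_append, ih, List.foldl_cons, List.foldl_nil, sum_range_succ]

open Classical in
theorem Computes.card {φ : Γ × ℕ → Mem → Prop} (h : Decides c.ext φ) :
    Computes c fun γ A => (#{i ∈ range (c.size γ) | φ (γ, i) A} : ℤ) :=
  (Computes.sum h).congr fun γ A => by simp only [sum_boole]

theorem Decides.exists_lt {φ : Γ × ℕ → Mem → Prop} (h : Decides c.ext φ) :
    Decides c fun γ A => ∃ i < c.size γ, φ (γ, i) A := by
  classical
  refine (Decides.lt (.const 0) (Computes.card h)).congr fun γ A => ?_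
  simp only [Nat.cast_pos, card_pos, filter_nonempty_iff, mem_range]

theorem Decides.forall_lt {φ : Γ × ℕ → Mem → Prop} (h : Decides c.ext φ) :
    Decides c fun γ A => ∀ i < c.size γ, φ (γ, i) A :=
  (Decides.exists_lt h.not).not.congr fun γ A => by simp only [not_exists, not_and, not_not]

theorem Transforms.loop (k : ℕ) {F : Γ × ℕ → Mem → Mem} (h : Transforms c.ext F) :
    Transforms c fun γ A => (List.range (c.size γ + k)).foldl (fun A i => F (γ, i) A) A := by
  refine (PolyTime.loop k h).congr fun γ A => ?_
  dsimp only
  induction List.range (c.size γ + k) generalizing A with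
  | nil => rfl
  | cons i l ih => simpa only [List.foldl_cons, add_zero] using ih (F (γ, i) A)

theorem Transforms.foldl {ι : Type*} (l : List ι) {F : ι → Γ → Mem → Mem}
    (h : ∀ i, Transforms c (F i)) : Transforms c fun γ A => l.foldl (fun A i => F i γ A) A := by
  induction l with
  | nil => exact Transforms.id
  | cons i l ih => exact (h i).comp ih

/-- The `m`-tuples of numbers less than `n`. -/
def tuples (n : ℕ) : (m : ℕ) → List (Fin m → ℕ)
  | 0 => [Fin.elim0]
  | m + 1 => (List.range n).flatMap fun i => (tuples n m).map (Fin.cons i)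

theorem mem_tuples {n m : ℕ} {K : Fin m → ℕ} (hK : ∀ j, K j < n) : K ∈ tuples n m := by
  induction m with
  | zero => exact List.mem_singleton.2 (Subsingleton.elim ..)
  | succ m ih =>
    exact List.mem_flatMap.2 ⟨K 0, List.mem_range.2 (hK 0),
      List.mem_map.2 ⟨Fin.tail K, ih fun j => hK j.succ, Fin.cons_self_tail K⟩⟩

theorem Transforms.loopTuple {m : ℕ} {F : Γ × (Fin m → ℕ) → Mem → Mem}
    (h : Transforms (c.extTuple m) F) :
    Transforms c fun γ A => (tuples (c.size γ) m).foldl (fun A K => F (γ, K) A) A := by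
  induction m generalizing Γ with
  | zero => exact PolyTime.comap h .extTuple_zero
  | succ m ih =>
    refine (Transforms.loop 0 (ih (PolyTime.comap h .extTuple_succ))).congr fun γ A => ?_
    simp only [tuples, List.foldl_flatMap, List.foldl_map, add_zero]
    rfl

end RAM

/-! ### Iterations -/

namespace RAM

section Iteration

variable {α ι κ : Type*} {f : α → ι → α} {l : List ι} {a : α}

theorem foldl_rel {r : α → α → Prop} [Std.Refl r] [IsTrans α r] (h : ∀ a, ∀ i ∈ l, r a (f a i)) :
    r a (l.foldl f a) :=
  List.foldlRecOn l f (refl a) fun b hb i hi => _root_.trans hb (h b i hi)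

theorem exists_foldl_rel {r : α → α → Prop} [Std.Refl r] [IsTrans α r]
    (h : ∀ a, ∀ i ∈ l, r a (f a i)) {j : ι} (hj : j ∈ l) :
    ∃ b, r a b ∧ r (f b j) (l.foldl f a) := by
  obtain ⟨l₁, l₂, rfl⟩ := List.append_of_mem hj
  simp only [List.mem_append, List.mem_cons] at h
  refine ⟨l₁.foldl f a, foldl_rel fun b i hi => h b i (.inl hi), ?_⟩
  rw [List.foldl_append, List.foldl_cons]
  exact foldl_rel fun b i hi => h b i (.inr (.inr hi))

theorem foldl_congr_of_invariant {key : α → κ} {F : κ → α → ι → α}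
    (h : ∀ k a i, key (F k a i) = key a) :
    l.foldl (fun b i => F (key b) b i) a = l.foldl (F (key a)) a := by
  induction l generalizing a with
  | nil => rfl
  | cons i l ih => rw [List.foldl_cons, List.foldl_cons, ih, h]

variable {I : α → Prop} {Φ : α → ℤ}

theorem foldl_eq_self_or_lt (hI : ∀ a, I a → ∀ i ∈ l, I (f a i))
    (hΦ : ∀ a, I a → ∀ i ∈ l, f a i = a ∨ Φ a < Φ (f a i)) (ha : I a) :
    (l.foldl f a = a ∧ ∀ i ∈ l, f a i = a) ∨ Φ a < Φ (l.foldl f a) := by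
  induction l generalizing a with
  | nil => exact .inl ⟨rfl, by simp⟩
  | cons i l ih =>
    simp only [List.forall_mem_cons] at hI hΦ ⊢
    have ih := ih (fun b hb => (hI b hb).2) (fun b hb => (hΦ b hb).2) (hI a ha).1
    rw [List.foldl_cons]
    rcases (hΦ a ha).1 with h | h
    · rw [h] at ih ⊢
      exact ih.imp_left fun ih => ⟨ih.1, rfl, ih.2⟩
    · refine .inr ?_
      rcases ih with ih | ih
      · rwa [ih.1]
      · exact h.trans ih

theorem iterate_eq_or_le {g : α → α} (hI : ∀ a, I a → I (g a))
    (hΦ : ∀ a, I a → g a = a ∨ Φ a < Φ (g a)) (ha : I a) (k : ℕ) :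
    g (g^[k] a) = g^[k] a ∨ Φ a + k ≤ Φ (g^[k] a) := by
  induction k generalizing a with
  | zero => exact .inr (by simp)
  | succ k ih =>
    rw [Function.iterate_succ_apply]
    rcases hΦ a ha with h | h
    · exact .inl (by rw [h, Function.iterate_fixed h, h])
    · refine (ih (hI a ha)).imp_right fun ih => ?_
      push_cast
      omega

end Iteration

/-! ### An auction for bipartite matchings -/

section Auction

/-- The memory with the value `x` in cell `i` of array `a`. -/
def write (A : Mem) (a : ℕ) (i x : ℤ) : Mem := Function.update A a (Function.update (A a) i x)

theorem write_apply_of_ne (A : Mem) {a b : ℕ} (h : b ≠ a) (i x : ℤ) : write A a i x b = A b :=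
  Function.update_of_ne h ..

theorem write_apply_self (A : Mem) (a : ℕ) (i x : ℤ) (j : ℤ) :
    write A a i x a j = if j = i then x else A a j := by
  rw [write, Function.update_self, Function.update_apply]

/-- The bidder `u` becomes the owner of the item `v`, at a price increased by one. Cell `v` of
array 9 is the price of the item `v`, and cell `v` of array 10 is its owner, or -1. -/
def placeBid (u v : ℕ) (A : Mem) : Mem := write (write A 10 v u) 9 v (A 9 v + 1)

/-- The bidder `u` owns no item, and `v` is one of its neighbours of least price. No bids are made
for items of price `n + 2`. -/
def CanBid (n : ℕ) (H : ℕ → ℕ → Prop) (u v : ℕ) (A : Mem) : Prop :=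
  (∀ w < n, A 10 w ≠ u) ∧ H u v ∧ A 9 v ≤ n + 1 ∧ ∀ w < n, H u w → A 9 v ≤ A 9 w

open Classical in
/-- The bid of `u` for `v`, provided that it is possible. -/
noncomputable def bid (n : ℕ) (H : ℕ → ℕ → Prop) (u v : ℕ) (A : Mem) : Mem :=
  if CanBid n H u v A then placeBid u v A else A

/-- A round of the auction, in which all bids are tried once. -/
noncomputable def auctionRound (n : ℕ) (H : ℕ → ℕ → Prop) (A : Mem) : Mem :=
  (List.range n ×ˢ List.range n).foldl (fun B p => bid n H p.1 p.2 B) A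

/-- The auction. Every round increases the sum of the prices, which is at most `n * (n + 2)`, unless
no bid is possible. -/
noncomputable def auction (n : ℕ) (H : ℕ → ℕ → Prop) : Mem → Mem :=
  (auctionRound n H)^[(n + 2) * (n + 2)]

/-- The invariant of the auction for the bipartite graph `H`: free items have price 0, and owners
paid at most one more than the price of every other neighbour. -/
structure AuctionInv (n : ℕ) (H : ℕ → ℕ → Prop) (A : Mem) : Prop where
  nonneg : ∀ v < n, 0 ≤ A 9 v
  le : ∀ v < n, A 9 v ≤ n + 2
  owner : ∀ v < n, (A 10 v = -1 ∧ A 9 v = 0) ∨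
    ∃ u < n, A 10 v = (u : ℕ) ∧ H u v ∧ ∀ w < n, H u w → A 9 v ≤ A 9 w + 1
  inj : ∀ v < n, ∀ w < n, v ≠ w → A 10 v = A 10 w → A 10 v = -1

/-- The sum of the prices. -/
def totalPrice (n : ℕ) (A : Mem) : ℤ := ∑ v ∈ Finset.range n, A 9 v

variable {n u v : ℕ} {H : ℕ → ℕ → Prop} {A : Mem}

theorem placeBid_price (u v w : ℕ) (A : Mem) :
    placeBid u v A 9 w = if w = v then A 9 v + 1 else A 9 w := by
  rw [placeBid, write_apply_self, write_apply_of_ne _ (by decide)]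
  simp only [Nat.cast_inj]

theorem placeBid_owner (u v w : ℕ) (A : Mem) :
    placeBid u v A 10 w = if w = v then (u : ℤ) else A 10 w := by
  rw [placeBid, write_apply_of_ne _ (by decide), write_apply_self]
  simp only [Nat.cast_inj]

theorem price_le_placeBid (u v w : ℕ) (A : Mem) : A 9 w ≤ placeBid u v A 9 w := by
  rw [placeBid_price]
  split_ifs with h
  · exact h ▸ (lt_add_one _).le
  · exact le_rfl

theorem totalPrice_lt_placeBid (hv : v < n) : totalPrice n A < totalPrice n (placeBid u v A) := by
  refine Finset.sum_lt_sum (fun w _ => price_le_placeBid ..) ⟨v, Finset.mem_range.2 hv, ?_⟩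
  rw [placeBid_price, if_pos rfl]
  exact lt_add_one _

theorem AuctionInv.placeBid (hA : AuctionInv n H A) (hu : u < n) (h : CanBid n H u v A) :
    AuctionInv n H (placeBid u v A) where
  nonneg w hw := (hA.nonneg w hw).trans (price_le_placeBid ..)
  le w hw := by
    rw [placeBid_price]
    split_ifs
    · linarith [h.2.2.1]
    · exact hA.le w hw
  owner w hw := by
    have paid {u' : ℕ} {x : ℤ} (hx : ∀ w < n, H u' w → x ≤ A 9 w + 1) :
        ∀ w < n, H u' w → x ≤ RAM.placeBid u v A 9 w + 1 := fun w hw huw =>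
      (hx w hw huw).trans (add_le_add_left (price_le_placeBid ..) 1)
    rw [placeBid_price, placeBid_owner]
    split_ifs with hwv
    · exact .inr ⟨u, hu, rfl, hwv ▸ h.2.1,
        paid fun x hx hux => add_le_add_left (h.2.2.2 x hx hux) 1⟩
    · refine (hA.owner w hw).imp_right ?_
      rintro ⟨u', hu', e, huw, hmin⟩
      exact ⟨u', hu', e, huw, paid hmin⟩
  inj w hw x hx hwx e := by
    rw [placeBid_owner, placeBid_owner] at e
    rw [placeBid_owner]
    split_ifs at e ⊢ with hwv hxv hxv
    · exact absurd (hwv.trans hxv.symm) hwx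
    · exact absurd e.symm (h.1 x hx)
    · exact absurd e (h.1 w hw)
    · exact hA.inj w hw x hx hwx e

theorem AuctionInv.bid (hA : AuctionInv n H A) (hu : u < n) : AuctionInv n H (bid n H u v A) := by
  unfold RAM.bid
  split_ifs with h
  · exact hA.placeBid hu h
  · exact hA

theorem bid_eq_self_or_totalPrice_lt (hv : v < n) :
    bid n H u v A = A ∨ totalPrice n A < totalPrice n (bid n H u v A) := by
  unfold bid
  split_ifs
  · exact .inr (totalPrice_lt_placeBid hv)
  · exact .inl rfl

theorem not_canBid_of_bid_eq_self (hv : v < n) (h : bid n H u v A = A) : ¬ CanBid n H u v A := by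
  intro hc
  rw [bid, if_pos hc] at h
  exact (totalPrice_lt_placeBid hv).ne (congrArg _ h.symm)

theorem AuctionInv.auctionRound (hA : AuctionInv n H A) : AuctionInv n H (auctionRound n H A) :=
  List.foldlRecOn _ _ hA fun _ hB _ hp =>
    hB.bid (List.mem_range.1 (List.mem_product.1 hp).1)

theorem auctionRound_eq_self_or_lt (hA : AuctionInv n H A) :
    (auctionRound n H A = A ∧ ∀ u < n, ∀ v < n, bid n H u v A = A) ∨
      totalPrice n A < totalPrice n (auctionRound n H A) := by
  refine (foldl_eq_self_or_lt (I := AuctionInv n H)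
    (fun B hB _ hp => hB.bid (List.mem_range.1 (List.mem_product.1 hp).1))
    (fun B _ _ hp => bid_eq_self_or_totalPrice_lt (List.mem_range.1 (List.mem_product.1 hp).2))
    hA).imp_left fun h => ⟨h.1, fun u hu v hv => h.2 (u, v) ?_⟩
  exact List.mem_product.2 ⟨List.mem_range.2 hu, List.mem_range.2 hv⟩

theorem AuctionInv.iterate (hA : AuctionInv n H A) (k : ℕ) :
    AuctionInv n H ((RAM.auctionRound n H)^[k] A) :=
  Function.Iterate.rec (AuctionInv n H) hA (fun _ hB => hB.auctionRound) k

theorem AuctionInv.totalPrice_nonneg (hA : AuctionInv n H A) : 0 ≤ totalPrice n A :=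
  Finset.sum_nonneg fun v hv => hA.nonneg v (Finset.mem_range.1 hv)

theorem AuctionInv.totalPrice_le (hA : AuctionInv n H A) : totalPrice n A ≤ n * (n + 2) := by
  simpa [totalPrice] using
    Finset.sum_le_card_nsmul _ _ _ fun v hv => hA.le v (Finset.mem_range.1 hv)

theorem AuctionInv.auction (hA : AuctionInv n H A) : AuctionInv n H (auction n H A) :=
  hA.iterate _

theorem not_canBid_auction (hA : AuctionInv n H A) (hu : u < n) (hv : v < n) :
    ¬ CanBid n H u v (auction n H A) := by
  have fixed : auctionRound n H (auction n H A) = auction n H A := by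
    refine (iterate_eq_or_le (Φ := totalPrice n) (fun _ hB => hB.auctionRound)
      (fun _ hB => (auctionRound_eq_self_or_lt hB).imp_left And.left) hA _).resolve_right
        fun h => ?_
    have hle : totalPrice n (auction n H A) ≤ _ := hA.auction.totalPrice_le
    have hnonneg := hA.totalPrice_nonneg
    unfold auction at hle
    push_cast at h
    nlinarith
  rcases auctionRound_eq_self_or_lt hA.auction with h | h
  · exact not_canBid_of_bid_eq_self hv (h.2 u hu v hv)
  · exact absurd h (by rw [fixed]; exact lt_irrefl _)

theorem auction_apply_of_ne {a : ℕ} (h9 : a ≠ 9) (h10 : a ≠ 10) (A : Mem) :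
    auction n H A a = A a := by
  have hbid (u v : ℕ) (B : Mem) : bid n H u v B a = B a := by
    unfold bid placeBid
    split_ifs
    · rw [write_apply_of_ne _ h9, write_apply_of_ne _ h10]
    · rfl
  have hround (B : Mem) : auctionRound n H B a = B a :=
    List.foldlRecOn (motive := fun D => D a = B a) _ _ rfl fun D hD p _ => (hbid _ _ D).trans hD
  exact Function.Iterate.rec (fun D => D a = A a) rfl (fun D hD => (hround D).trans hD) _

theorem exists_price_gap (n : ℕ) (p : ℕ → ℤ) :
    ∃ ℓ ∈ Finset.Icc 1 (n + 1), ∀ v < n, p v ≠ (ℓ : ℕ) := by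
  by_contra! h
  choose! f hfn hf using h
  have hmaps : Set.MapsTo f (Finset.Icc 1 (n + 1)) (Finset.range n) := fun ℓ hℓ =>
    Finset.mem_coe.2 (Finset.mem_range.2 (hfn ℓ hℓ))
  refine absurd (Finset.card_le_card_of_injOn f hmaps fun ℓ hℓ ℓ' hℓ' e => ?_) (by simp)
  exact_mod_cast (hf ℓ hℓ).symm.trans ((congrArg p e).trans (hf ℓ' hℓ'))

/-- The bidders in `L` that own no item of price at most the level `ℓ`, and the items in `R` of
price at most `ℓ`. -/
def AboveBelow (n : ℕ) (L R : ℕ → Prop) (A : Mem) (ℓ w : ℕ) : Prop :=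
  (L w ∧ ∀ v < n, A 10 v = w → (ℓ : ℤ) < A 9 v) ∨ (R w ∧ A 9 w ≤ ℓ)

variable {L R : ℕ → Prop} {ℓ : ℕ}

theorem AuctionInv.adj_of_owner (hA : AuctionInv n H A) (hv : v < n) (hown : A 10 v = u) :
    H u v ∧ ∀ w < n, H u w → A 9 v ≤ A 9 w + 1 := by
  rcases hA.owner v hv with ⟨h, -⟩ | ⟨u', -, h, h'⟩
  · omega
  · obtain rfl : u' = u := by exact_mod_cast h.symm.trans hown
    exact h'

/-- The neighbours of a bidder above the level `ℓ` have prices at least `ℓ`, hence more than `ℓ` by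
`hgap`, or else `n + 2`. -/
theorem AuctionInv.not_adj_of_aboveBelow (hA : AuctionInv n H A)
    (hstable : ∀ u < n, ∀ v < n, ¬ CanBid n H u v A) (hLR : ∀ w, L w → ¬ R w)
    (hH : ∀ u v, H u v → L u ∧ R v) (hℓ : ℓ ≤ n + 1) (hgap : ∀ v < n, A 9 v ≠ ℓ) (hu : u < n)
    (hv : v < n) (hJu : AboveBelow n L R A ℓ u) (hJv : AboveBelow n L R A ℓ v) : ¬ H u v := by
  classical
  intro huv
  have above : ∀ w < n, A 10 w = u → (ℓ : ℤ) < A 9 w :=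
    (hJu.resolve_right fun h => hLR u (hH u v huv).1 h.1).2
  have below : A 9 v < ℓ :=
    (hJv.resolve_left fun h => hLR v h.1 (hH u v huv).2).2.lt_of_ne (hgap v hv)
  by_cases hown : ∃ w < n, A 10 w = u
  · obtain ⟨w, hw, e⟩ := hown
    have := above w hw e
    have := (hA.adj_of_owner hw e).2 v hv huv
    omega
  · push Not at hown
    obtain ⟨x, hx, hmin⟩ := Finset.exists_min_image {x ∈ Finset.range n | H u x} (fun x => A 9 x)
      ⟨v, by simpa using ⟨hv, huv⟩⟩
    simp only [Finset.mem_filter, Finset.mem_range] at hx hmin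
    refine hstable u hu x hx.1 ⟨hown, hx.2, ?_, fun w hw huw => hmin w ⟨hw, huw⟩⟩
    have := hmin v ⟨hv, huv⟩
    omega

/-- `y` is matched to `x` at a price that keeps `x` out of the independent set
`AboveBelow n L R A ℓ`. -/
def Blocks (H : ℕ → ℕ → Prop) (A : Mem) (ℓ x y : ℕ) : Prop :=
  (H x y ∧ A 10 y = x ∧ A 9 y ≤ ℓ) ∨ (H y x ∧ A 10 x = y ∧ (ℓ : ℤ) < A 9 x)

theorem AuctionInv.exists_blocks (hA : AuctionInv n H A) {x : ℕ} (hx : x < n) (hLR : L x ∨ R x)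
    (hJ : ¬ AboveBelow n L R A ℓ x) : ∃ y < n, Blocks H A ℓ x y := by
  simp only [AboveBelow, not_or, not_and, not_forall, not_lt, not_le] at hJ
  rcases hLR with h | h
  · obtain ⟨y, hy, e, hle⟩ := hJ.1 h
    exact ⟨y, hy, .inl ⟨(hA.adj_of_owner hy e).1, e, hle⟩⟩
  · have hlt := hJ.2 h
    rcases hA.owner x hx with ⟨-, h0⟩ | ⟨y, hy, e, hyx, -⟩
    · omega
    · exact ⟨y, hy, .inr ⟨hyx, e, hlt⟩⟩

theorem Blocks.adj {x y : ℕ} (h : Blocks H A ℓ x y) : H x y ∨ H y x := h.imp And.left And.left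

theorem AuctionInv.aboveBelow_of_blocks (hA : AuctionInv n H A) (hH : ∀ u v, H u v → L u ∧ R v)
    {x y : ℕ} (hx : x < n) (h : Blocks H A ℓ x y) : AboveBelow n L R A ℓ y := by
  rcases h with ⟨hxy, -, hle⟩ | ⟨hyx, e, hlt⟩
  · exact .inr ⟨(hH x y hxy).2, hle⟩
  · refine .inl ⟨(hH y x hyx).1, fun v hv e' => ?_⟩
    by_contra hle
    have hne : x ≠ v := by rintro rfl; exact hle hlt
    have := hA.inj x hx v hv hne (e.trans e'.symm)
    omega

theorem AuctionInv.blocks_unique (hA : AuctionInv n H A) (hLR : ∀ w, L w → ¬ R w)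
    (hH : ∀ u v, H u v → L u ∧ R v) {x x' y : ℕ} (hx : x < n) (hx' : x' < n)
    (h : Blocks H A ℓ x y) (h' : Blocks H A ℓ x' y) : x = x' := by
  rcases h with ⟨hxy, e, -⟩ | ⟨hyx, e, -⟩ <;> rcases h' with ⟨hxy', e', -⟩ | ⟨hyx', e', -⟩
  · exact_mod_cast e.symm.trans e'
  · exact absurd (hH x y hxy).2 (hLR y (hH y x' hyx').1)
  · exact absurd (hH x' y hxy').2 (hLR y (hH y x hyx).1)
  · by_contra hne
    have := hA.inj x hx x' hx' hne (e.trans e'.symm)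
    omega

open Classical in
theorem AuctionInv.card_le_card_aboveBelow (hA : AuctionInv n H A) (hLR : ∀ w, L w → ¬ R w)
    (hH : ∀ u v, H u v → L u ∧ R v) {Q : Finset ℕ} (hQ : ∀ x ∈ Q, x < n ∧ (L x ∨ R x))
    (hind : ∀ x ∈ Q, ∀ y ∈ Q, ¬ H x y) :
    Q.card ≤ {w ∈ Finset.range n | AboveBelow n L R A ℓ w}.card := by
  rw [← Finset.card_sdiff_le_card_sdiff_iff]
  refine Finset.card_le_card_of_forall_subsingleton (Blocks H A ℓ) (fun x hx => ?_)
    fun y _ x hx x' hx' => hA.blocks_unique hLR hH (hQ x (Finset.mem_sdiff.1 hx.1).1).1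
      (hQ x' (Finset.mem_sdiff.1 hx'.1).1).1 hx.2 hx'.2
  simp only [Finset.mem_sdiff, Finset.mem_filter, Finset.mem_range, not_and] at hx ⊢
  have hxn := (hQ x hx.1).1
  obtain ⟨y, hy, hxy⟩ := hA.exists_blocks hxn (hQ x hx.1).2 (hx.2 hxn)
  refine ⟨y, ⟨⟨hy, hA.aboveBelow_of_blocks hH hxn hxy⟩, fun hyQ => ?_⟩, hxy⟩
  exact hxy.adj.elim (hind x hx.1 y hyQ) (hind y hyQ x hx.1)

end Auction

end RAM

/-! ### The algorithm -/

open Corners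
open scoped Function

namespace RAM

section Programs

variable {Γ : Type} {c : Ctx Γ}

theorem Ctx.Hom.comp {Γ' Γ'' : Type} {c' : Ctx Γ'} {c'' : Ctx Γ''} {g : Γ' → Γ} {g' : Γ'' → Γ'}
    (h : c''.Hom c' g') (h' : c'.Hom c g) : c''.Hom c (g ∘ g') where
  size_eq γ := (h'.size_eq _).trans (h.size_eq γ)
  comp_mem v hv := h.comp_mem _ (h'.comp_mem v hv)

theorem Ctx.Hom.fst_fst : c.ext.ext.Hom c.ext fun γ => (γ.1.1, γ.2) :=
  .cons (.comp .fst .fst) Ctx.snd_mem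

theorem Decides.comap {Γ' : Type} {c' : Ctx Γ'} {g : Γ' → Γ} {φ : Γ → Mem → Prop}
    (h : Decides c φ) (hg : c'.Hom c g) : Decides c' fun γ A => φ (g γ) A := by
  classical exact PolyTime.comap (F := fun γ A => (A, if φ γ A then 1 else 0)) h hg

/-- The corners of the path of vertex `w`, in the arrays from 0 to 7. -/
def memCorners (A : Mem) (w : ℕ) : Corners := fun j o => A (2 * j.val + o.toNat) w

theorem memCorners_write {a : ℕ} (ha : 8 ≤ a) (A : Mem) (i x : ℤ) :
    memCorners (write A a i x) = memCorners A := by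
  funext w j o
  have := o.toNat_le
  rw [memCorners, write_apply_of_ne _ (by omega), memCorners]

theorem Decides.seg {u : Γ → ℕ} (hu : Computes c fun γ _ => (u γ : ℤ)) (o : Bool) (i j : Fin 4) :
    Decides c fun γ A => Seg (memCorners A (u γ)) o i j :=
  (Decides.const _).and ((Decides.eq (hu.load _) (hu.load _)).and
    (Decides.lt (hu.load _) (hu.load _)))

theorem Decides.share {u v : Γ → ℕ} (hu : Computes c fun γ _ => (u γ : ℤ))
    (hv : Computes c fun γ _ => (v γ : ℤ)) :
    Decides c fun γ A => (Share on memCorners A) (u γ) (v γ) := by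
  have key : Decides c fun γ A => ∃ o i j k l, Seg (memCorners A (u γ)) o i j ∧
      Seg (memCorners A (v γ)) o k l ∧ memCorners A (v γ) k (!o) = memCorners A (u γ) i (!o) ∧
      memCorners A (u γ) i o < memCorners A (v γ) l o ∧
      memCorners A (v γ) k o < memCorners A (u γ) j o :=
    .exists_finite fun o => .exists_finite fun i => .exists_finite fun j =>
      .exists_finite fun k => .exists_finite fun l => (Decides.seg hu o i j).and
        ((Decides.seg hv o k l).and ((Decides.eq (hv.load _) (hu.load _)).and
          ((Decides.lt (hu.load _) (hv.load _)).and (Decides.lt (hv.load _) (hu.load _)))))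
  refine key.congr fun γ A => ⟨?_, ?_⟩
  · rintro ⟨o, i, j, k, l, hij, hkl, hline, hil, hkj⟩
    exact ⟨o, _, _, _, _, _, hij.hasSeg, ⟨k, l, hkl, hline, rfl, rfl⟩, hil, hkj⟩
  · rintro ⟨o, a, _, _, _, _, ⟨i, j, hij, rfl, rfl, rfl⟩, ⟨k, l, hkl, hline, rfl, rfl⟩, hil, hkj⟩
    exact ⟨o, i, j, k, l, hij, hkl, hline, hil, hkj⟩

theorem Decides.cmp_eq {τ σ : Γ → Mem → ℤ} (hτ : Computes c τ) (hσ : Computes c σ) (r : Ordering) :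
    Decides c fun γ A => cmp (τ γ A) (σ γ A) = r := by
  cases r with
  | lt => exact (Decides.lt hτ hσ).congr fun γ A => (cmp_eq_lt_iff _ _).symm
  | eq => exact (Decides.eq hτ hσ).congr fun γ A => (cmp_eq_eq_iff _ _).symm
  | gt => exact (Decides.lt hσ hτ).congr fun γ A => (cmp_eq_gt_iff _ _).symm

theorem Decides.pattern_mem {m : ℕ} {f : Γ → Fin m → ℕ} {u : Γ → ℕ}
    (hf : ∀ k, Computes c fun γ _ => (f γ k : ℤ)) (hu : Computes c fun γ _ => (u γ : ℤ))
    (S : Set (Pattern m)) :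
    Decides c fun γ A => pattern (memCorners A) (f γ) (u γ) ∈ S := by
  have key : Decides c fun γ A => ∃ τ : Pattern m, τ ∈ S ∧
      (∀ i o j o', cmp (memCorners A (u γ) i o) (memCorners A (u γ) j o') = τ.1 i o j o') ∧
      ∀ k i o j o', cmp (memCorners A (u γ) i o) (memCorners A (f γ k) j o') = τ.2 k i o j o' :=
    .exists_finite fun τ => (Decides.const _).and (.and
      (.forall_finite fun i => .forall_finite fun o => .forall_finite fun j =>
        .forall_finite fun o' => .cmp_eq (hu.load _) (hu.load _) _)
      (.forall_finite fun k => .forall_finite fun i => .forall_finite fun o =>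
        .forall_finite fun j => .forall_finite fun o' => .cmp_eq (hu.load _) ((hf k).load _) _))
  refine key.congr fun γ A => ⟨?_, fun h => ⟨_, h, fun _ _ _ _ => rfl, fun _ _ _ _ _ => rfl⟩⟩
  rintro ⟨τ, hτ, hself, hfamily⟩
  have : pattern (memCorners A) (f γ) (u γ) = τ :=
    Prod.ext (by funext i o j o'; exact hself i o j o')
      (by funext k i o j o'; exact hfamily k i o j o')
  rwa [this]

/-- The transformation `F` of the arrays, which also depends on the corners of the paths, can be
performed in polynomial time, and does not change the arrays from 0 to 7 with the corners. -/
def TransformsWork (c : Ctx Γ) (F : Γ → (ℕ → Corners) → Mem → Mem) : Prop :=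
  Transforms c (fun γ A => F γ (memCorners A) A) ∧
    ∀ γ z A, memCorners (F γ z A) = memCorners A

namespace TransformsWork

variable {F G : Γ → (ℕ → Corners) → Mem → Mem}

theorem congr (h : TransformsWork c F) (e : ∀ γ z A, F γ z A = G γ z A) : TransformsWork c G := by
  rwa [show G = F from funext₃ fun γ z A => (e γ z A).symm]

theorem store {a : ℕ} (ha : 8 ≤ a) {τ : Γ → Mem → ℤ} {σ : Γ → (ℕ → Corners) → Mem → ℤ}
    (hτ : Computes c τ) (hσ : Computes c fun γ A => σ γ (memCorners A) A) :
    TransformsWork c fun γ z A => write A a (τ γ A) (σ γ z A) :=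
  ⟨.store a hτ hσ, fun _ _ _ => memCorners_write ha ..⟩

theorem id : TransformsWork c fun _ _ A => A := ⟨.id, fun _ _ _ => rfl⟩

theorem comp (hF : TransformsWork c F) (hG : TransformsWork c G) :
    TransformsWork c fun γ z A => G γ z (F γ z A) :=
  ⟨(hF.1.comp hG.1).congr fun γ A => by rw [hF.2], fun γ z A => (hG.2 ..).trans (hF.2 ..)⟩

open Classical in
theorem ite {φ : Γ → (ℕ → Corners) → Mem → Prop} (hφ : Decides c fun γ A => φ γ (memCorners A) A)
    (hF : TransformsWork c F) (hG : TransformsWork c G) :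
    TransformsWork c fun γ z A => if φ γ z A then F γ z A else G γ z A := by
  refine ⟨.ite hφ hF.1 hG.1, fun γ z A => ?_⟩
  beta_reduce
  split_ifs
  · exact hF.2 γ z A
  · exact hG.2 γ z A

theorem comap {Γ' : Type} {c' : Ctx Γ'} {g : Γ' → Γ} (h : TransformsWork c F)
    (hg : c'.Hom c g) : TransformsWork c' fun γ => F (g γ) :=
  ⟨PolyTime.comap h.1 hg, fun γ => h.2 (g γ)⟩

theorem of_foldl {ι : Type*} {l : Γ → List ι} {F : Γ → ι → (ℕ → Corners) → Mem → Mem}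
    (h : Transforms c fun γ A => (l γ).foldl (fun B i => F γ i (memCorners B) B) A)
    (h' : ∀ γ i z A, memCorners (F γ i z A) = memCorners A) :
    TransformsWork c fun γ z A => (l γ).foldl (fun B i => F γ i z B) A :=
  ⟨h.congr fun γ _ => foldl_congr_of_invariant (F := fun z B i => F γ i z B)
      fun z B i => h' γ i z B,
    fun _ _ A => List.foldlRecOn (motive := fun B => memCorners B = memCorners A) _ _ rfl
      fun _ hB _ _ => (h' ..).trans hB⟩

theorem loop (k : ℕ) {F : Γ × ℕ → (ℕ → Corners) → Mem → Mem} (h : TransformsWork c.ext F) :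
    TransformsWork c fun γ z A => (List.range (c.size γ + k)).foldl (fun B i => F (γ, i) z B) A :=
  of_foldl (.loop k h.1) fun γ i => h.2 (γ, i)

theorem foldl {ι : Type*} (l : List ι) {F : ι → Γ → (ℕ → Corners) → Mem → Mem}
    (h : ∀ i, TransformsWork c (F i)) :
    TransformsWork c fun γ z A => l.foldl (fun B i => F i γ z B) A :=
  of_foldl (.foldl l fun i => (h i).1) fun γ i => (h i).2 γ

theorem loopTuple {m : ℕ} {F : Γ × (Fin m → ℕ) → (ℕ → Corners) → Mem → Mem}
    (h : TransformsWork (c.extTuple m) F) :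
    TransformsWork c fun γ z A => (tuples (c.size γ) m).foldl (fun B K => F (γ, K) z B) A :=
  of_foldl (.loopTuple h.1) fun γ K => h.2 (γ, K)

theorem loop_product {F : (Γ × ℕ) × ℕ → (ℕ → Corners) → Mem → Mem}
    (h : TransformsWork c.ext.ext F) :
    TransformsWork c fun γ z A => (List.range (c.size γ) ×ˢ List.range (c.size γ)).foldl
      (fun B p => F ((γ, p.1), p.2) z B) A :=
  (loop 0 (loop (c := c.ext) 0 h)).congr fun γ z A => by
    simp only [SProd.sprod, List.product, List.foldl_flatMap, List.foldl_map]
    rfl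

theorem iterate (k : ℕ) (h : TransformsWork c F) :
    TransformsWork c fun γ z => (F γ z)^[(c.size γ + k) * (c.size γ + k)] :=
  (loop k (loop (c := c.ext) k ((h.comap .fst).comap .fst))).congr fun γ z A => by
    rw [Function.iterate_mul]
    simp only [Ctx.ext, Ctx.cons, List.foldl_const, List.length_range]

end TransformsWork

/-- The first `n` cells of array `a` get the values of `x`. -/
def fill (n a : ℕ) (x : ℕ → ℤ) (A : Mem) : Mem :=
  (List.range n).foldl (fun B (w : ℕ) => write B a w (x w)) A

theorem fill_apply_of_ne (n : ℕ) {a b : ℕ} (h : b ≠ a) (x : ℕ → ℤ) (A : Mem) :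
    fill n a x A b = A b :=
  List.foldlRecOn (motive := fun B => B b = A b) _ _ rfl
    fun B hB _ _ => (write_apply_of_ne B h ..).trans hB

theorem fill_apply_self {n w : ℕ} (hw : w < n) (a : ℕ) (x : ℕ → ℤ) (A : Mem) :
    fill n a x A a w = x w := by
  rw [fill]
  induction n with
  | zero => exact absurd hw w.not_lt_zero
  | succ n ih =>
    rw [List.range_succ, List.foldl_append, List.foldl_cons, List.foldl_nil, write_apply_self]
    split_ifs with h
    · rw [Nat.cast_inj.1 h]
    · exact ih (by omega)

theorem TransformsWork.fill {a : ℕ} (ha : 8 ≤ a) {x : Γ → (ℕ → Corners) → Mem → ℕ → ℤ}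
    (hx : ∀ γ z A i y, x γ z (write A a i y) = x γ z A)
    (h : Computes c.ext fun γ A => x γ.1 (memCorners A) A γ.2) :
    TransformsWork c fun γ z A => fill (c.size γ) a (x γ z A) A :=
  (loop (c := c) 0 (store (c := c.ext) (σ := fun γ z A => x γ.1 z A γ.2) ha Computes.last h)).congr
    fun γ z _ => foldl_congr_of_invariant (key := x γ z) (F := fun k B (w : ℕ) => write B a w (k w))
      fun _ B i => hx γ z B i _

theorem TransformsWork.placeBid :
    TransformsWork c.ext.ext fun γ _ => placeBid γ.1.2 γ.2 :=
  (store (c := c.ext.ext) (a := 10) (σ := fun γ _ _ => (γ.1.2 : ℤ)) (by decide) .last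
    (.var (Ctx.fst_mem Ctx.snd_mem))).comp
    (store (c := c.ext.ext) (a := 9) (σ := fun γ _ A => A 9 γ.2 + 1) (by decide) .last
      (.add (Computes.last.load 9) (.const 1)))

theorem Decides.canBid {H : Γ → (ℕ → Corners) → ℕ → ℕ → Prop}
    (hH : Decides c.ext.ext fun γ A => H γ.1.1 (memCorners A) γ.1.2 γ.2) :
    Decides c.ext.ext fun γ A => CanBid (c.size γ.1.1) (H γ.1.1 (memCorners A)) γ.1.2 γ.2 A := by
  have free : Decides c.ext.ext fun γ A => ∀ w < c.size γ.1.1, A 10 w ≠ (γ.1.2 : ℕ) :=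
    .forall_lt (c := c.ext.ext) (φ := fun γ A => A 10 γ.2 ≠ (γ.1.1.2 : ℕ))
      (Decides.eq (Computes.last.load 10) (.var (Ctx.fst_mem (Ctx.fst_mem Ctx.snd_mem)))).not
  have cheapest : Decides c.ext.ext fun γ A =>
      ∀ w < c.size γ.1.1, H γ.1.1 (memCorners A) γ.1.2 w → A 9 γ.2 ≤ A 9 w :=
    .forall_lt (c := c.ext.ext)
      (φ := fun γ A => H γ.1.1.1 (memCorners A) γ.1.1.2 γ.2 → A 9 γ.1.2 ≤ A 9 γ.2)
      (.imp (hH.comap .fst_fst)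
        (.le (.load 9 (.var (Ctx.fst_mem Ctx.snd_mem))) (Computes.last.load 9)))
  exact free.and (hH.and (.and (.le (Computes.last.load 9) (.add .size (.const 1))) cheapest))

theorem TransformsWork.auction {H : Γ → (ℕ → Corners) → ℕ → ℕ → Prop}
    (hH : Decides c.ext.ext fun γ A => H γ.1.1 (memCorners A) γ.1.2 γ.2) :
    TransformsWork c fun γ z => auction (c.size γ) (H γ z) :=
  .iterate 2 (.loop_product
    (F := fun (γ : (Γ × ℕ) × ℕ) z => bid (c.size γ.1.1) (H γ.1.1 z) γ.1.2 γ.2)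
    (.ite (φ := fun (γ : (Γ × ℕ) × ℕ) z => CanBid (c.size γ.1.1) (H γ.1.1 z) γ.1.2 γ.2)
      (.canBid hH) .placeBid .id))

theorem aboveBelow_congr {n ℓ : ℕ} {L R : ℕ → Prop} {A B : Mem} (h9 : A 9 = B 9)
    (h10 : A 10 = B 10) : AboveBelow n L R A ℓ = AboveBelow n L R B ℓ := by
  unfold AboveBelow
  rw [h9, h10]

theorem Decides.aboveBelow {L R : Γ → (ℕ → Corners) → ℕ → Prop}
    (hL : Decides c.ext fun γ A => L γ.1 (memCorners A) γ.2)
    (hR : Decides c.ext fun γ A => R γ.1 (memCorners A) γ.2) :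
    Decides c.ext.ext fun γ A => AboveBelow (c.size γ.1.1) (L γ.1.1 (memCorners A))
      (R γ.1.1 (memCorners A)) A γ.1.2 γ.2 := by
  have above : Decides c.ext.ext fun γ A =>
      ∀ v < c.size γ.1.1, A 10 v = (γ.2 : ℕ) → ((γ.1.2 : ℕ) : ℤ) < A 9 v :=
    .forall_lt (c := c.ext.ext)
      (φ := fun γ A => A 10 γ.2 = (γ.1.2 : ℕ) → ((γ.1.1.2 : ℕ) : ℤ) < A 9 γ.2)
      (.imp (.eq (Computes.last.load 10) (.var (Ctx.fst_mem Ctx.snd_mem)))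
        (.lt (.var (Ctx.fst_mem (Ctx.fst_mem Ctx.snd_mem))) (Computes.last.load 9)))
  exact ((hL.comap .fst_fst).and above).or ((hR.comap .fst_fst).and
    (.le (Computes.last.load 9) (.var (Ctx.fst_mem Ctx.snd_mem))))

/-- The vertices that are marked by a 1 in array `a`. -/
def marked (n a : ℕ) (A : Mem) : Finset ℕ := {w ∈ Finset.range n | A a w = 1}

theorem mem_marked {n a w : ℕ} {A : Mem} : w ∈ marked n a A ↔ w < n ∧ A a w = 1 := by
  rw [marked, Finset.mem_filter, Finset.mem_range]

theorem Computes.card_marked (a : ℕ) :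
    Computes c fun γ A => ((marked (c.size γ) a A).card : ℤ) :=
  (Computes.card (φ := fun γ A => A a γ.2 = 1) (.eq (Computes.last.load a) (.const 1))).congr
    fun γ A => by rw [marked]; congr!

theorem Decides.pairwise_share_marked (a : ℕ) :
    Decides c fun γ A =>
      (marked (c.size γ) a A : Set ℕ).Pairwise (Share on memCorners A) := by
  have key : Decides c fun γ A => ∀ u < c.size γ, ∀ v < c.size γ, A a u = 1 → A a v = 1 →
      u ≠ v → (Share on memCorners A) u v := by
    refine .forall_lt (φ := fun γ A => ∀ v < c.size γ.1, A a γ.2 = 1 → A a v = 1 → γ.2 ≠ v →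
      (Share on memCorners A) γ.2 v) (.forall_lt (c := c.ext) (φ := fun γ A =>
        A a γ.1.2 = 1 → A a γ.2 = 1 → γ.1.2 ≠ γ.2 → (Share on memCorners A) γ.1.2 γ.2) ?_)
    have fst : Computes c.ext.ext fun γ _ => (γ.1.2 : ℤ) := .var (Ctx.fst_mem Ctx.snd_mem)
    exact .imp (.eq (fst.load a) (.const 1)) (.imp (.eq (Computes.last.load a) (.const 1))
      (.imp (Decides.not ((Decides.eq fst .last).congr fun _ _ => Nat.cast_inj))
        (.share fst .last)))
  refine key.congr fun γ A => ?_
  simp only [Set.Pairwise, Finset.mem_coe, mem_marked]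
  exact ⟨fun h u hu v hv huv => h u hu.1 v hv.1 hu.2 hv.2 huv,
    fun h u hu v hv au av huv => h ⟨hu, au⟩ ⟨hv, av⟩ huv⟩

open Classical in
/-- The set marked in array 11 replaces the one in array 8 if it is a larger clique. -/
noncomputable def adopt (n : ℕ) (z : ℕ → Corners) (A : Mem) : Mem :=
  if (marked n 11 A : Set ℕ).Pairwise (Share on z) ∧ (marked n 8 A).card < (marked n 11 A).card
  then fill n 8 (fun w => A 11 w) A else A

theorem TransformsWork.adopt : TransformsWork c fun γ => adopt (c.size γ) := by
  have copy : TransformsWork c fun γ _ A => RAM.fill (c.size γ) 8 (fun w => A 11 w) A :=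
    .fill (x := fun _ _ A w => A 11 w) le_rfl
      (fun _ _ A i y => by rw [write_apply_of_ne A (by decide)]) (Computes.last.load 11)
  have larger : Decides c fun γ A => (marked (c.size γ) 8 A).card < (marked (c.size γ) 11 A).card :=
    (Decides.lt (.card_marked 8) (.card_marked 11)).congr fun _ _ => Nat.cast_lt
  exact (TransformsWork.ite (φ := fun γ z A =>
    (marked (c.size γ) 11 A : Set ℕ).Pairwise (Share on z) ∧
      (marked (c.size γ) 8 A).card < (marked (c.size γ) 11 A).card)
    ((Decides.pairwise_share_marked 11).and larger) copy .id).congr fun γ z A => by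
      unfold RAM.adopt
      congr

open Classical in
/-- The set `AboveBelow n L R A ℓ` is marked in array 11, and then considered for array 8. -/
noncomputable def select (n : ℕ) (z : ℕ → Corners) (L R : ℕ → Prop) (ℓ : ℕ) (A : Mem) : Mem :=
  adopt n z (fill n 11 (fun w => if AboveBelow n L R A ℓ w then 1 else 0) A)

/-- The candidates of all levels are considered for array 8, after an auction for the bipartite
graph formed by the pairs of a vertex in `L` and one in `R` without a common edge. -/
noncomputable def improve (n : ℕ) (z : ℕ → Corners) (L R : ℕ → Prop) (A : Mem) : Mem :=
  (List.range (n + 2)).foldl (fun B ℓ => select n z L R ℓ B)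
    (auction n (fun u v => L u ∧ R v ∧ ¬ (Share on z) u v)
      (fill n 10 (fun _ => -1) (fill n 9 (fun _ => 0) A)))

section

variable {L R : Γ → (ℕ → Corners) → ℕ → Prop}

open Classical in
theorem TransformsWork.select (hL : Decides c.ext fun γ A => L γ.1 (memCorners A) γ.2)
    (hR : Decides c.ext fun γ A => R γ.1 (memCorners A) γ.2) :
    TransformsWork c.ext fun γ z => select (c.size γ.1) z (L γ.1 z) (R γ.1 z) γ.2 := by
  have mark : TransformsWork c.ext fun γ z A => RAM.fill (c.size γ.1) 11 (fun w =>
      if AboveBelow (c.size γ.1) (L γ.1 z) (R γ.1 z) A γ.2 w then 1 else 0) A :=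
    .fill (c := c.ext) (a := 11) (x := fun γ z A w =>
      if AboveBelow (c.size γ.1) (L γ.1 z) (R γ.1 z) A γ.2 w then 1 else 0) (by decide)
      (fun γ z A i y => by
        rw [aboveBelow_congr (write_apply_of_ne A (by decide) ..)
          (write_apply_of_ne A (by decide) ..)])
      (.ite (.aboveBelow hL hR) (.const 1) (.const 0))
  exact mark.comp (adopt (c := c.ext))

theorem TransformsWork.improve (hL : Decides c.ext fun γ A => L γ.1 (memCorners A) γ.2)
    (hR : Decides c.ext fun γ A => R γ.1 (memCorners A) γ.2) :
    TransformsWork c fun γ z => improve (c.size γ) z (L γ z) (R γ z) := by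
  have clear (a : ℕ) (ha : 8 ≤ a) (x : ℤ) :
      TransformsWork c fun γ _ => RAM.fill (c.size γ) a fun _ => x :=
    .fill (x := fun _ _ _ _ => x) ha (fun _ _ _ _ _ => rfl) (.const x)
  refine (((clear 9 (by decide) 0).comp (clear 10 (by decide) (-1))).comp (.auction
    (H := fun γ z u v => L γ z u ∧ R γ z v ∧ ¬ (Share on z) u v) ?_)).comp
    (.loop 2 (.select hL hR))
  exact (hL.comap .fst).and ((hR.comap .fst_fst).and
    (Decides.share (c := c.ext.ext) (u := fun γ => γ.1.2) (v := fun γ => γ.2)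
      (.var (Ctx.fst_mem Ctx.snd_mem)) .last).not)

end

instance {m : ℕ} : Finite (Set (Pattern m)) := Set.instFinite

/-- All pairs of sets of patterns. -/
noncomputable def patternPairs (m : ℕ) : List (Set (Pattern m) × Set (Pattern m)) :=
  (@Finset.univ _ (Fintype.ofFinite _)).toList

/-- The covers by two cliques that are unions of order types over `K` are considered for
array 8. -/
noncomputable def improveOver {m : ℕ} (n : ℕ) (z : ℕ → Corners) (K : Fin m → ℕ) (A : Mem) : Mem :=
  (patternPairs m).foldl (fun B p =>
    improve n z (fun w => pattern z K w ∈ p.1) (fun w => pattern z K w ∈ p.2 \ p.1) B) A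

/-- The algorithm starts with the clique of vertex 0, and improves it over all the families of `m`
vertices. -/
noncomputable def cliqueAlgorithm (m n : ℕ) (z : ℕ → Corners) (A : Mem) : Mem :=
  (tuples n m).foldl (fun B K => improveOver n z K B) (write A 8 0 1)

theorem TransformsWork.improveOver (m : ℕ) :
    TransformsWork (c.extTuple m) fun γ z => improveOver (c.size γ.1) z γ.2 := by
  have mem (S : Set (Pattern m)) : Decides (c.extTuple m).ext
      fun γ A => pattern (memCorners A) γ.1.2 γ.2 ∈ S :=
    .pattern_mem (fun k => .var (Ctx.fst_mem (v := fun γ : Γ × (Fin m → ℕ) => (γ.2 k : ℤ))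
      (by simp [Ctx.extTuple]))) .last S
  have step (p : Set (Pattern m) × Set (Pattern m)) : TransformsWork (c.extTuple m)
      fun γ z => RAM.improve (c.size γ.1) z (fun w => pattern z γ.2 w ∈ p.1)
        fun w => pattern z γ.2 w ∈ p.2 \ p.1 := by
    apply TransformsWork.improve
    · exact mem p.1
    · exact mem (p.2 \ p.1)
  exact .foldl (patternPairs m) step

theorem TransformsWork.cliqueAlgorithm (m : ℕ) :
    TransformsWork c fun γ => cliqueAlgorithm m (c.size γ) := by
  have init : TransformsWork c fun _ _ A => write A 8 0 1 :=
    .store (τ := fun _ _ => 0) (σ := fun _ _ _ => 1) le_rfl (.const 0) (.const 1)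
  exact init.comp (.loopTuple (.improveOver m))

end Programs

end RAM

/-! ### Correctness -/

open Corners
open scoped Function

namespace RAM

section Correctness

variable {n a ℓ : ℕ} {z : ℕ → Corners} {L R : ℕ → Prop} {A B : Mem}

/-- Array 8 holds the indicator function of a clique. -/
structure HoldsClique (n : ℕ) (z : ℕ → Corners) (A : Mem) : Prop where
  indicator : ∀ w < n, A 8 w = 0 ∨ A 8 w = 1
  pairwise : (marked n 8 A : Set ℕ).Pairwise (Share on z)

/-- A change of the memory that does not spoil or shrink the clique in array 8. -/
structure Improves (n : ℕ) (z : ℕ → Corners) (A B : Mem) : Prop where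
  holdsClique : HoldsClique n z A → HoldsClique n z B
  card_le : (marked n 8 A).card ≤ (marked n 8 B).card

instance : Std.Refl (Improves n z) := ⟨fun _ => ⟨id, le_rfl⟩⟩

instance : IsTrans Mem (Improves n z) :=
  ⟨fun _ _ _ h h' => ⟨h'.holdsClique ∘ h.holdsClique, h.card_le.trans h'.card_le⟩⟩

theorem Improves.of_eq (h : B 8 = A 8) : Improves n z A B := by
  have hm : marked n 8 B = marked n 8 A := by simp only [marked, h]
  exact ⟨fun hA => ⟨h ▸ hA.indicator, hm ▸ hA.pairwise⟩, (congr_arg Finset.card hm).ge⟩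

theorem marked_fill_self (x : ℕ → ℤ) :
    marked n a (fill n a x A) = {w ∈ Finset.range n | x w = 1} :=
  Finset.filter_congr fun w hw => by rw [fill_apply_self (Finset.mem_range.1 hw)]

theorem adopt_apply_of_ne (h : a ≠ 8) (A : Mem) : adopt n z A a = A a := by
  unfold adopt
  split_ifs
  · exact fill_apply_of_ne n h ..
  · rfl

theorem Improves.adopt (h : ∀ w < n, A 11 w = 0 ∨ A 11 w = 1) : Improves n z A (adopt n z A) := by
  unfold RAM.adopt
  split_ifs with hc
  · refine ⟨fun _ => ⟨fun w hw => ?_, ?_⟩, ?_⟩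
    · rw [fill_apply_self hw]
      exact h w hw
    · exact (marked_fill_self (fun w => A 11 w)).symm ▸ hc.1
    · exact (marked_fill_self (fun w => A 11 w)).symm ▸ hc.2.le
  · exact refl A

theorem card_marked_le_adopt (h : (marked n 11 A : Set ℕ).Pairwise (Share on z)) :
    (marked n 11 A).card ≤ (marked n 8 (adopt n z A)).card := by
  unfold adopt
  split_ifs with hc
  · exact (congr_arg Finset.card (marked_fill_self fun w => A 11 w)).ge
  · exact not_lt.1 fun hlt => hc ⟨h, hlt⟩

theorem select_apply_of_ne (h8 : a ≠ 8) (h11 : a ≠ 11) (A : Mem) :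
    select n z L R ℓ A a = A a :=
  (adopt_apply_of_ne h8 _).trans (fill_apply_of_ne n h11 ..)

theorem Improves.select : Improves n z A (select n z L R ℓ A) := by
  classical
  refine _root_.trans (.of_eq (fill_apply_of_ne n (by decide) ..)) (.adopt fun w hw => ?_)
  rw [fill_apply_self hw]
  exact (ite_eq_or_eq ..).symm

open Classical in
theorem card_aboveBelow_le_select
    (h : {w | w < n ∧ AboveBelow n L R A ℓ w}.Pairwise (Share on z)) :
    {w ∈ Finset.range n | AboveBelow n L R A ℓ w}.card ≤
      (marked n 8 (select n z L R ℓ A)).card := by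
  have hm : marked n 11 (fill n 11 (fun w => if AboveBelow n L R A ℓ w then 1 else 0) A) =
      {w ∈ Finset.range n | AboveBelow n L R A ℓ w} := by
    simp only [marked_fill_self, ite_eq_left_iff, zero_ne_one, imp_false, not_not]
  rw [← hm]
  refine card_marked_le_adopt ?_
  rw [hm]
  simpa only [Finset.coe_filter, Finset.mem_range] using h

open Classical in
theorem card_aboveBelow_le_foldl_select {l : List ℕ} (hℓ : ℓ ∈ l)
    (h : {w | w < n ∧ AboveBelow n L R A ℓ w}.Pairwise (Share on z)) :
    {w ∈ Finset.range n | AboveBelow n L R A ℓ w}.card ≤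
      (marked n 8 (l.foldl (fun B k => select n z L R k B) A)).card := by
  induction l generalizing A with
  | nil => exact absurd hℓ List.not_mem_nil
  | cons k l ih =>
    rw [List.foldl_cons]
    rcases List.mem_cons.1 hℓ with rfl | hℓ
    · exact (card_aboveBelow_le_select h).trans
        (foldl_rel (r := Improves n z) fun _ _ _ => .select).card_le
    · have e : AboveBelow n L R A ℓ = AboveBelow n L R (select n z L R k A) ℓ :=
        aboveBelow_congr (select_apply_of_ne (by decide) (by decide) A).symm
          (select_apply_of_ne (by decide) (by decide) A).symm
      rw [e] at h ⊢
      exact ih hℓ h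

theorem Improves.improve : Improves n z A (improve n z L R A) := by
  refine _root_.trans (.of_eq ?_) (foldl_rel fun _ _ _ => .select)
  rw [auction_apply_of_ne (by decide) (by decide), fill_apply_of_ne n (by decide),
    fill_apply_of_ne n (by decide)]

theorem auctionInv_clear (n : ℕ) (H : ℕ → ℕ → Prop) (A : Mem) :
    AuctionInv n H (fill n 10 (fun _ => -1) (fill n 9 (fun _ => 0) A)) := by
  have price : ∀ v < n, fill n 10 (fun _ => -1) (fill n 9 (fun _ => 0) A) 9 v = 0 :=
    fun v hv => by rw [fill_apply_of_ne n (by decide), fill_apply_self hv]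
  have owner : ∀ v < n, fill n 10 (fun _ => -1) (fill n 9 (fun _ => 0) A) 10 v = -1 :=
    fun v hv => fill_apply_self hv ..
  exact ⟨fun v hv => (price v hv).ge, fun v hv => (price v hv).trans_le (by positivity),
    fun v hv => .inl ⟨owner v hv, price v hv⟩, fun v hv _ _ _ _ => owner v hv⟩

theorem card_le_improve (hLR : ∀ w, L w → ¬ R w)
    (hL : ∀ u < n, ∀ v < n, L u → L v → Share (z u) (z v))
    (hR : ∀ u < n, ∀ v < n, R u → R v → Share (z u) (z v)) {Q : Finset ℕ}
    (hQ : ∀ x ∈ Q, x < n ∧ (L x ∨ R x)) (hshare : ∀ x ∈ Q, ∀ y ∈ Q, Share (z x) (z y)) :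
    Q.card ≤ (marked n 8 (improve n z L R A)).card := by
  classical
  set H : ℕ → ℕ → Prop := fun u v => L u ∧ R v ∧ ¬ (Share on z) u v
  set D := auction n H (fill n 10 (fun _ => -1) (fill n 9 (fun _ => 0) A))
  have hclear := auctionInv_clear n H A
  have hinv : AuctionInv n H D := hclear.auction
  have hH : ∀ u v, H u v → L u ∧ R v := fun _ _ h => ⟨h.1, h.2.1⟩
  obtain ⟨ℓ, hℓ, hgap⟩ := exists_price_gap n fun v => D 9 v
  have hℓ' : ℓ ≤ n + 1 := (Finset.mem_Icc.1 hℓ).2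
  refine (hinv.card_le_card_aboveBelow (ℓ := ℓ) hLR hH hQ fun x hx y hy h =>
    h.2.2 (hshare x hx y hy)).trans (card_aboveBelow_le_foldl_select
      (List.mem_range.2 (by omega)) ?_)
  have hind {u v : ℕ} (hu : u < n) (hv : v < n) (hJu : AboveBelow n L R D ℓ u)
      (hJv : AboveBelow n L R D ℓ v) : ¬ H u v :=
    hinv.not_adj_of_aboveBelow (fun u hu v hv => not_canBid_auction hclear hu hv) hLR hH hℓ' hgap
      hu hv hJu hJv
  rintro u ⟨hu, hJu⟩ v ⟨hv, hJv⟩ -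
  rcases hJu.imp And.left And.left with hLu | hRu <;>
    rcases hJv.imp And.left And.left with hLv | hRv
  · exact hL u hu v hv hLu hLv
  · exact not_not.1 fun h => hind hu hv hJu hJv ⟨hLu, hRv, h⟩
  · exact not_not.1 fun h => hind hv hu hJv hJu ⟨hLv, hRu, fun h' => h h'.symm⟩
  · exact hR u hu v hv hRu hRv

variable {m : ℕ} {K : Fin m → ℕ}

theorem Improves.improveOver : Improves n z A (improveOver n z K A) :=
  foldl_rel fun _ _ _ => .improve

theorem card_le_improveOver {S T : Set (Pattern m)}
    (hS : ∀ u < n, ∀ v < n, pattern z K u ∈ S → pattern z K v ∈ S → Share (z u) (z v))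
    (hT : ∀ u < n, ∀ v < n, pattern z K u ∈ T → pattern z K v ∈ T → Share (z u) (z v))
    {Q : Finset ℕ} (hQ : ∀ x ∈ Q, x < n ∧ (pattern z K x ∈ S ∨ pattern z K x ∈ T))
    (hshare : ∀ x ∈ Q, ∀ y ∈ Q, Share (z x) (z y)) :
    Q.card ≤ (marked n 8 (improveOver n z K A)).card := by
  have hmem : (S, T) ∈ patternPairs m :=
    Finset.mem_toList.2 (@Finset.mem_univ _ (Fintype.ofFinite _) _)
  obtain ⟨B, -, hB⟩ := exists_foldl_rel (r := Improves n z) (a := A) (f := fun B p =>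
    improve n z (fun w => pattern z K w ∈ p.1) (fun w => pattern z K w ∈ p.2 \ p.1) B)
    (fun _ _ _ => .improve) hmem
  exact (card_le_improve (fun w h h' => h'.2 h) hS
    (fun u hu v hv h h' => hT u hu v hv h.1 h'.1)
    (fun x hx => ⟨(hQ x hx).1, Set.union_sdiff_self.ge (hQ x hx).2⟩) hshare).trans hB.card_le

theorem improves_cliqueAlgorithm :
    Improves n z (write A 8 0 1) (cliqueAlgorithm m n z A) :=
  foldl_rel fun _ _ _ => .improveOver

theorem marked_write_zero (hn : 0 < n) (hA : ∀ w < n, A 8 w = 0) :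
    marked n 8 (write A 8 0 1) = {0} := by
  ext w
  rw [mem_marked, write_apply_self, Finset.mem_singleton]
  refine ⟨fun ⟨hw, h⟩ => ?_, fun h => ⟨h ▸ hn, by rw [h, Nat.cast_zero, if_pos rfl]⟩⟩
  by_contra h0
  rw [if_neg (by exact_mod_cast h0), hA w hw] at h
  exact zero_ne_one h

theorem holdsClique_cliqueAlgorithm (hA : ∀ w < n, A 8 w = 0) :
    HoldsClique n z (cliqueAlgorithm m n z A) := by
  refine improves_cliqueAlgorithm.holdsClique ⟨fun w hw => ?_, fun u hu => ?_⟩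
  · rw [write_apply_self, hA w hw]
    exact (ite_eq_or_eq ..).symm
  · have hn : 0 < n := Nat.zero_lt_of_lt (mem_marked.1 hu).1
    rw [marked_write_zero hn hA, Finset.coe_singleton] at hu ⊢
    exact Set.pairwise_singleton _ _ hu

theorem one_le_card_cliqueAlgorithm (hn : 0 < n) (hA : ∀ w < n, A 8 w = 0) :
    1 ≤ (marked n 8 (cliqueAlgorithm m n z A)).card := by
  have := (improves_cliqueAlgorithm (n := n) (z := z) (A := A) (m := m)).card_le
  rwa [marked_write_zero hn hA, Finset.card_singleton] at this

theorem card_le_cliqueAlgorithm {S T : Set (Pattern m)} (hK : ∀ j, K j < n)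
    (hS : ∀ u < n, ∀ v < n, pattern z K u ∈ S → pattern z K v ∈ S → Share (z u) (z v))
    (hT : ∀ u < n, ∀ v < n, pattern z K u ∈ T → pattern z K v ∈ T → Share (z u) (z v))
    {Q : Finset ℕ} (hQ : ∀ x ∈ Q, x < n ∧ (pattern z K x ∈ S ∨ pattern z K x ∈ T))
    (hshare : ∀ x ∈ Q, ∀ y ∈ Q, Share (z x) (z y)) :
    Q.card ≤ (marked n 8 (cliqueAlgorithm m n z A)).card := by
  obtain ⟨B, -, hB⟩ := exists_foldl_rel (r := Improves n z) (a := write A 8 0 1)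
    (f := fun B K => improveOver n z K B) (fun _ _ _ => .improveOver) (mem_tuples hK)
  exact (card_le_improveOver hS hT hQ hshare).trans hB.card_le

theorem share_of_pairwise {Q : Finset ℕ} (hQ : (Q : Set ℕ).Pairwise (Share on z))
    (hcard : 1 < Q.card) {x y : ℕ} (hx : x ∈ Q) (hy : y ∈ Q) : Share (z x) (z y) := by
  by_cases hxy : x = y
  · subst hxy
    obtain ⟨w, hw, hne⟩ := Finset.exists_mem_ne hcard x
    exact Share.self_left (hQ hx hw hne.symm)
  · exact hQ hx hy hxy

theorem exists_card_le_cliqueAlgorithm : ∃ m, ∀ {n : ℕ} {z : ℕ → Corners} {A : Mem},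
    (∀ w < n, Valid (z w)) → (∀ w < n, A 8 w = 0) → ∀ {Q : Finset ℕ}, (∀ x ∈ Q, x < n) →
      (Q : Set ℕ).Pairwise (Share on z) →
        Q.card ≤ (marked n 8 (cliqueAlgorithm m n z A)).card := by
  obtain ⟨m, hm⟩ := exists_pattern_cover
  refine ⟨m, fun {n z A} hz hA Q hQn hQ => ?_⟩
  rcases Q.eq_empty_or_nonempty with rfl | ⟨x₀, hx₀⟩
  · exact Nat.zero_le _
  rcases le_or_gt Q.card 1 with hle | hlt
  · exact hle.trans (one_le_card_cliqueAlgorithm (Nat.zero_lt_of_lt (hQn x₀ hx₀)) hA)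
  have hshare : ∀ x ∈ Q, ∀ y ∈ Q, Share (z x) (z y) := fun x hx y hy =>
    share_of_pairwise hQ hlt hx hy
  obtain ⟨f, S, T, hST, hS, hT⟩ :=
    hm (fun i : Fin n => z i) {i : Fin n | i.val ∈ Q} ⟨⟨x₀, hQn x₀ hx₀⟩, hx₀⟩
      (fun v => hz v v.isLt) fun x hx y hy => hshare x hx y hy
  exact card_le_cliqueAlgorithm (fun j => (f j).isLt) (fun u hu v hv => hS ⟨u, hu⟩ ⟨v, hv⟩)
    (fun u hu v hv => hT ⟨u, hu⟩ ⟨v, hv⟩) (fun x hx => ⟨hQn x hx, hST ⟨x, hQn x hx⟩ hx⟩) hshare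

end Correctness

end RAM

section Graph

open RAM

variable {n : ℕ} {G : SimpleGraph (Fin n)} (R : EPGRep 2 G)

theorem EPGRep.memCorners_input (w : Fin n) : memCorners R.input.arr w = R.corners w := by
  funext j o
  have ho := o.toNat_le
  have h : 2 * j.val + o.toNat < 8 ∧ (0 : ℤ) ≤ (w : ℕ) ∧ ((w : ℕ) : ℤ) < n := by omega
  have hdiv : (2 * j.val + o.toNat) / 2 = j.val := by omega
  simp only [memCorners, EPGRep.input, dif_pos h, EPGRep.corners, gridCoord, Int.toNat_natCast,
    Fin.eta, hdiv]
  cases o <;> simp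

theorem EPGRep.isClique_iff {C : Finset (Fin n)} : G.IsClique C ↔
    (C.map Fin.valEmbedding : Set ℕ).Pairwise (Share on memCorners R.input.arr) := by
  rw [Finset.coe_map, Fin.valEmbedding.injective.injOn.pairwise_image]
  refine forall₂_congr fun u _ => forall₂_congr fun v _ => forall_congr' fun huv => ?_
  simp only [R.adj_iff_share, Function.onFun, Fin.valEmbedding_apply, R.memCorners_input, huv,
    ne_eq, not_false_eq_true, true_and]

theorem map_val_filter_eq_marked (n a : ℕ) (A : Mem) :
    ({i | A a (i : ℕ) = 1} : Finset (Fin n)).map Fin.valEmbedding = marked n a A := by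
  ext w
  simp only [mem_marked, Finset.mem_map, Finset.mem_filter_univ, Fin.valEmbedding_apply]
  exact ⟨fun ⟨i, hi, h⟩ => h ▸ ⟨i.isLt, hi⟩, fun h => ⟨⟨w, h.1⟩, h.2, rfl⟩⟩

theorem exists_cliqueAlgorithm_isMaximumClique :
    ∃ m, ∀ {n : ℕ} {G : SimpleGraph (Fin n)} (R : EPGRep 2 G),
      ∃ C : Finset (Fin n), G.IsMaximumClique C ∧ ∀ i : Fin n,
        cliqueAlgorithm m n (memCorners R.input.arr) R.input.arr 8 (i : ℕ) =
          if i ∈ C then 1 else 0 := by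
  obtain ⟨m, hm⟩ := exists_card_le_cliqueAlgorithm
  refine ⟨m, fun {n G} R => ?_⟩
  set D := cliqueAlgorithm m n (memCorners R.input.arr) R.input.arr
  have hzero : ∀ w < n, R.input.arr 8 (w : ℕ) = 0 := fun _ _ => by simp [EPGRep.input]
  have hvalid : ∀ w < n, Valid (memCorners R.input.arr w) := fun w hw =>
    R.memCorners_input ⟨w, hw⟩ ▸ R.valid_corners _
  have hD : HoldsClique n (memCorners R.input.arr) D := holdsClique_cliqueAlgorithm hzero
  refine ⟨({i | D 8 (i : ℕ) = 1} : Finset (Fin n)), ⟨?_, fun Q hQ => ?_⟩, fun i => ?_⟩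
  · rw [R.isClique_iff, map_val_filter_eq_marked]
    exact hD.pairwise
  · rw [← Finset.card_map Fin.valEmbedding, ← Finset.card_map Fin.valEmbedding,
      map_val_filter_eq_marked]
    refine hm hvalid hzero (fun x hx => ?_) (R.isClique_iff.1 hQ)
    obtain ⟨i, -, rfl⟩ := Finset.mem_map.1 hx
    exact i.isLt
  · simp only [Finset.mem_filter_univ]
    rcases hD.indicator i i.isLt with h | h <;> simp [h]

end Graph

/-- There is a program that, given a `B_2`-EPG graph `G` on `n` vertices through its
representation, halts within a number of steps polynomial in `n`, having computed a maximum clique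
`C` of `G` (its indicator function is then in array 8). -/
theorem mainTheorem1 :
    ∃ (P : RAM.Prog) (q : Polynomial ℕ),
      ∀ (n : ℕ) (G : SimpleGraph (Fin n)) (R : EPGRep 2 G),
        ∃ (t : ℕ) (s : RAM.State), RAM.Exec P R.input t s ∧ t ≤ q.eval n ∧
          ∃ C : Finset (Fin n), G.IsMaximumClique C ∧
            ∀ i : Fin n, s.arr 8 ((i : ℕ) : ℤ) = if i ∈ C then 1 else 0 := by
  obtain ⟨m, hm⟩ := exists_cliqueAlgorithm_isMaximumClique
  obtain ⟨P, q, hP⟩ := (RAM.TransformsWork.cliqueAlgorithm (c := ⟨fun n : ℕ => n, []⟩) m).1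
    (fun _ => 0) 1 ⟨one_pos, fun _ _ => one_pos⟩
  refine ⟨P, q, fun n G R => ?_⟩
  obtain ⟨t, s, hexec, ht, -, hs, -⟩ := hP n R.input ⟨rfl, by simp⟩
  exact ⟨t, s, hexec, ht, by rw [hs]; exact hm R⟩
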